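/- Let $P=(X,\le)$ be a finite non-empty poset. Its comparability graph $G_P$ has vertex set $X$, with $x,y$ adjacent iff $x<y$ or $y<x$. A set $M\subseteq X$ is a \emph{module} if every $y\in X\setminus M$ is comparable to all elements of $M$ or to none of them. A module $M$ is \emph{strong} if for every module $M'$ one has $M\cap M'=\varnothing$, $M\subseteq M'$ or $M'\subseteq M$; it is \emph{nontrivial} if $|M|\ge 2$ and $M\ne X$. It is a \emph{clique module} if the complement of the comparability graph of the subposet induced by $M$ is not connected. A \emph{CPT representation} of $P$ consists of a finite tree $T$ and pairwise distinct paths $W_x$ ($x\in X$) of $T$, viewed as non-empty vertex sets, such that $x<y$ if and only if $W_x\subsetneq W_y$. The poset $P$ is \emph{dually-CPT} if both $P$ and its dual have a CPT representation. A path is \emph{trivial} if it has a single vertex. In a CPT representation, $W_x$ \emph{ends on the trivial path} $W_z=\{a\}$ if $a$ is an end vertex of $W_x$ (so a trivial path ends on itself). Let $M$ be a nontrivial strong module. We say that \emph{the paths of $M$ do not end on a trivial path} in a representation if no $W_m$ with $m\in M$ ends on a trivial path $W_z$, for any $z\in X$; if no element of $X\setminus M$ is comparable to an element of $M$ (i.e.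 $M$ is a connected component of $G_P$), this is required only for $z\in X\setminus M$. We say that $M$ is \emph{blocked} in a representation if there is a vertex $a$ of $T$ such that - every $W_m$, $m\in M$, has $a$ as an end vertex; - $W_z=\{a\}$ for some $z\in X\setminus M$; - $M$ is not free at $a$, i.e. there is no neighbour $b$ of $a$ in $T$ such that $b\notin W_m$ for all $m\in M$ and $b\in W_x$ for every $x\in X\setminus M$ with $W_m\subseteq W_x$ for all $m\in M$. \textbf{Theorem.} Let $P$ be a dually-CPT poset. (1) For every nontrivial strong module $M$ of $P$, either $P$ has a CPT representation in which the paths of $M$ do not end on a trivial path, or $M$ is a clique module that is blocked in every CPT representation of $P$. (2) $P$ has a \emph{normalized representation}, i.e. a single CPT representation in which, for every nontrivial strong module $M$, either the paths of $M$ do not end on a trivial path, or $M$ is a clique module that is blocked in this representation. -/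

import Mathlib

namespace CPT

/-! ### Comparability graph and modules of a poset -/

/-- The comparability graph of a poset: `x` and `y` are adjacent iff `x < y` or `y < x`. -/
def compGraph (X : Type*) [PartialOrder X] : SimpleGraph X where
  Adj x y := x < y ∨ y < x
  symm := ⟨fun _ _ h => h.symm⟩
  loopless := ⟨fun x h => h.elim (lt_irrefl x) (lt_irrefl x)⟩

/-- `M` is a module: every element outside `M` is comparable to all the elements of `M`, or
incomparable to all of them. -/
def IsModule {X : Type*} [PartialOrder X] (M : Set X) : Prop :=
  ∀ y, y ∉ M → (∀ x ∈ M, (compGraph X).Adj y x) ∨ (∀ x ∈ M, ¬ (compGraph X).Adj y x)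

/-- A module is strong if it overlaps no module. -/
def IsStrongModule {X : Type*} [PartialOrder X] (M : Set X) : Prop :=
  IsModule M ∧ ∀ M' : Set X, IsModule M' → M ∩ M' = ∅ ∨ M ⊆ M' ∨ M' ⊆ M

/-- A nontrivial strong module: a strong module that is neither a singleton nor the whole
ground set (nor empty). -/
def IsNontrivialStrongModule {X : Type*} [PartialOrder X] (M : Set X) : Prop :=
  IsStrongModule M ∧ M.Nontrivial ∧ M ≠ Set.univ

/-- The module `M` is a clique (series) module: the complement of the comparability graph of the
subposet induced by `M` is not connected. (Only used for `M` with at least two elements.) -/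
def IsCliqueModule {X : Type*} [PartialOrder X] (M : Set X) : Prop :=
  ¬ (((compGraph X).induce M)ᶜ).Connected

/-! ### Representations by paths in a tree -/

/-- `W` is the vertex set of a path of `T` one of whose end vertices is `a`. -/
def IsPathEndingAt {V : Type*} (T : SimpleGraph V) (W : Set V) (a : V) : Prop :=
  ∃ (v : V) (p : T.Walk a v), p.IsPath ∧ W = {w | w ∈ p.support}

/-- A CPT representation of the poset `X`: distinct paths (as vertex sets) of a finite host tree,
such that `x < y` iff the path of `x` is properly contained in the path of `y`. -/
structure Rep (X : Type*) [PartialOrder X] where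
  /-- the vertices of the host tree -/
  V : Type
  finite_V : Finite V
  /-- the host tree -/
  T : SimpleGraph V
  isTree : T.IsTree
  /-- the path representing an element -/
  path : X → Set V
  isPath : ∀ x, ∃ a, IsPathEndingAt T (path x) a
  injective : Function.Injective path
  lt_iff : ∀ x y, x < y ↔ path x ⊂ path y

/-- `X` is a CPT poset. -/
def IsCPT (X : Type*) [PartialOrder X] : Prop := Nonempty (Rep X)

/-- `X` is dually-CPT: both `X` and its dual are CPT posets. -/
def IsDuallyCPT (X : Type*) [PartialOrder X] : Prop := IsCPT X ∧ IsCPT Xᵒᵈ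

namespace Rep

variable {X : Type*} [PartialOrder X]

/-- The path of `x` ends at the vertex `a`. -/
def EndsAt (R : Rep X) (x : X) (a : R.V) : Prop := IsPathEndingAt R.T (R.path x) a

/-- The path of `z` is trivial (a single vertex), and the path of `x` ends at that vertex.
(In particular a trivial path ends on itself.) -/
def EndsOnTrivial (R : Rep X) (x z : X) : Prop :=
  ∃ a : R.V, R.path z = {a} ∧ R.EndsAt x a

/-- The paths of `M` do not end on a trivial path. Trivial paths of all elements `z` count, inside
or outside `M`, except when no element outside `M` is comparable to an element of `M`
(so `M` is a union of connected components), where only those of elements outside `M` count. -/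
def AvoidsTrivial (R : Rep X) (M : Set X) : Prop :=
  ∀ m ∈ M, ∀ z : X, (z ∉ M ∨ ∃ y, y ∉ M ∧ ∃ x ∈ M, (compGraph X).Adj y x) →
    ¬ R.EndsOnTrivial m z

/-- `M`, bounded at the vertex `a`, is free: `a` has a neighbour `b` such that no path of `M` passes
through `b`, while the path of every element outside `M` that contains all the paths of `M`
passes through `b`. -/
def IsFreeAt (R : Rep X) (M : Set X) (a : R.V) : Prop :=
  ∃ b : R.V, R.T.Adj a b ∧ (∀ m ∈ M, b ∉ R.path m) ∧
    ∀ x, x ∉ M → (∀ m ∈ M, R.path m ⊆ R.path x) → b ∈ R.path x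

/-- `M` is blocked in `R`: all its paths end at a common vertex `a` which hosts the trivial path of
some element outside `M`, and `M` is not free at `a`. -/
def IsBlocked (R : Rep X) (M : Set X) : Prop :=
  ∃ a : R.V, (∀ m ∈ M, R.EndsAt m a) ∧ (∃ z, z ∉ M ∧ R.path z = {a}) ∧ ¬ R.IsFreeAt M a

/-- A normalized representation: for every nontrivial strong module, its paths do not end on a
trivial path, or it is a clique module blocked in this representation. -/
def IsNormalized (R : Rep X) : Prop :=
  ∀ M : Set X, IsNontrivialStrongModule M →
    R.AvoidsTrivial M ∨ (IsCliqueModule M ∧ R.IsBlocked M)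

end Rep

end CPT

/-! Everything follows from a dichotomy, `Rep.exists_avoiding_or_isBlocked`. Let `M` be a nontrivial
strong module whose paths do end on trivial paths in a representation `R`. Either `M` is a clique
module blocked in `R`, or `R` can be modified so that no path of `M` ends on a trivial path and no
new pair (path, trivial path it ends on) arises. For (1), if no representation is good for `M`, the
second alternative never occurs. For (2), a representation with the fewest such pairs is normalized,
since a modification would destroy a pair.

A strong module sees each outside element as lower, upper or incomparable
(`IsStrongModule.isOrderModule`). When `M` has an upper element, or a lower one by way of the dual
representation, its elements are intervals of one path, so `M` embeds in a product of two chains. It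
can then be redrawn along any suitable path `Q` of the tree (`exists_avoiding_of_path`): the two
extreme edges of `Q` are subdivided, and every new path of `M` covers the core of `Q` and stops
among the new vertices, at distances given by the two chain coordinates.

It remains to find `Q`. If `M` has a trivial path, an edge at it works. Otherwise some `m` in `M`
has an end `v` hosting no lower trivial path. If the other end `u` hosts none either, `Q` is the
path of `m`; if `u` does, `Q` is that path prolonged by a neighbour of `u` common to all upper
paths. If there is no such neighbour, all paths of `M` end at `u` and leave it through the same
edge, so they are nested: `M` is a chain, and blocked (`isBlocked_of_forall_adj`). -/

namespace CPT

/-! ### Paths as lists of vertices -/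

section Lists

variable {V : Type*} {T : SimpleGraph V}

/-- `l` lists the consecutive vertices of a (possibly empty) path of `T`. -/
structure IsPathList (T : SimpleGraph V) (l : List V) : Prop where
  chain : l.IsChain T.Adj
  nodup : l.Nodup

theorem IsPathList.infix {l l' : List V} (h : IsPathList T l) (h' : l' <:+: l) :
    IsPathList T l' := ⟨h.1.infix h', h.2.sublist h'.sublist⟩

theorem IsPathList.reverse {l : List V} (h : IsPathList T l) : IsPathList T l.reverse := by
  refine ⟨List.isChain_reverse.2 (h.1.imp fun _ _ h => h.symm), List.nodup_reverse.2 h.2⟩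

theorem IsPathList.exists_walk {a b : V} {l : List V} (h : IsPathList T (a :: l))
    (hb : (a :: l).getLast (by simp) = b) :
    ∃ p : T.Walk a b, p.IsPath ∧ p.support = a :: l := by
  have hs : ((SimpleGraph.Walk.ofSupport (a :: l) (List.cons_ne_nil _ _) h.1).copy
      (List.head_cons) hb).support = a :: l := by
    rw [SimpleGraph.Walk.support_copy, SimpleGraph.Walk.support_ofSupport]
  exact ⟨_, (SimpleGraph.Walk.isPath_def _).2 (by rw [hs]; exact h.2), hs⟩

theorem isPathEndingAt_iff_list {W : Set V} {a : V} :
    IsPathEndingAt T W a ↔ ∃ l, IsPathList T (a :: l) ∧ W = {w | w ∈ a :: l} := by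
  constructor
  · rintro ⟨v, p, hp, rfl⟩
    refine ⟨p.support.tail, ?_, ?_⟩
    · rw [SimpleGraph.Walk.cons_tail_support]
      exact ⟨p.isChain_adj_support, hp.support_nodup⟩
    · rw [SimpleGraph.Walk.cons_tail_support]
  · rintro ⟨l, h, rfl⟩
    obtain ⟨p, hp, hs⟩ := h.exists_walk rfl
    exact ⟨_, p, hp, by rw [hs]⟩

theorem exists_isPathEndingAt_iff_list {W : Set V} :
    (∃ a, IsPathEndingAt T W a) ↔ ∃ l, l ≠ [] ∧ IsPathList T l ∧ W = {w | w ∈ l} := by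
  simp_rw [isPathEndingAt_iff_list]
  constructor
  · rintro ⟨a, l, h, h'⟩; exact ⟨a :: l, by simp, h, h'⟩
  · rintro ⟨_ | ⟨a, l⟩, h0, h, h'⟩
    · simp at h0
    · exact ⟨a, l, h, h'⟩

theorem IsPathList.unique (hT : T.IsAcyclic) {a b : V} {l l' : List V} (h : IsPathList T (a :: l))
    (h' : IsPathList T (a :: l')) (hb : (a :: l).getLast (by simp) = b)
    (hb' : (a :: l').getLast (by simp) = b) : l = l' := by
  obtain ⟨p, hp, hs⟩ := h.exists_walk hb
  obtain ⟨p', hp', hs'⟩ := h'.exists_walk hb'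
  have key := congrArg (fun p => p.1.support)
    ((hT.subsingleton_path _ _).elim ⟨p, hp⟩ ⟨p', hp'⟩)
  simpa [hs, hs'] using key

theorem IsPathList.unique' (hT : T.IsAcyclic) {a b : V} {l l' : List V}
    (h : IsPathList T (a :: l ++ [b])) (h' : IsPathList T (a :: l' ++ [b])) : l = l' := by
  have := IsPathList.unique (b := b) hT h h' (by simp) (by simp)
  simpa using this

/-- Two distinct members of a list are joined by an infix of the list or of its reverse. -/
theorem exists_infix_of_mem {l : List V} {s t : V} (hs : s ∈ l) (ht : t ∈ l) (hst : s ≠ t) :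
    ∃ k, (s :: k ++ [t] <:+: l) ∨ (s :: k ++ [t] <:+: l.reverse) := by
  obtain ⟨l1, l2, rfl⟩ := List.append_of_mem hs
  rcases List.mem_append.1 ht with h | h
  · obtain ⟨k1, k2, rfl⟩ := List.append_of_mem h
    exact ⟨k2.reverse, Or.inr ⟨l2.reverse, k1.reverse, by simp⟩⟩
  · rcases List.mem_cons.1 h with h | h
    · exact absurd h.symm hst
    · obtain ⟨k1, k2, rfl⟩ := List.append_of_mem h
      exact ⟨k1, Or.inl ⟨l1, k2, by simp⟩⟩

/-- The part of `l` joining `s` and `t` must be `k` itself, because paths in a forest are determined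
by their ends. -/
theorem IsPathList.subset_of_ends (hT : T.IsAcyclic) {l k : List V} {s t : V}
    (hl : IsPathList T l) (hs : s ∈ l) (ht : t ∈ l) (hk : IsPathList T (s :: k ++ [t])) :
    s :: k ++ [t] <:+: l ∨ s :: k ++ [t] <:+: l.reverse := by
  have hst : s ≠ t := by
    rintro rfl
    have := hk.2
    simp at this
  obtain ⟨k', h | h⟩ := exists_infix_of_mem hs ht hst
  · rw [hk.unique' hT (hl.infix h)]; exact Or.inl h
  · rw [hk.unique' hT (hl.reverse.infix h)]; exact Or.inr h

/-- The vertex set of a path in a forest is convex. -/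
theorem convex_of_isPathList (hT : T.IsAcyclic) {l k : List V} {s t : V}
    (hl : IsPathList T l) (hs : s ∈ l) (ht : t ∈ l) (hk : IsPathList T (s :: k ++ [t])) :
    ∀ x ∈ s :: k ++ [t], x ∈ l := by
  intro x hx
  rcases hl.subset_of_ends hT hs ht hk with h | h
  · exact h.subset hx
  · simpa using h.subset hx

/-- On a path of a forest starting at `a`, the only neighbour of `a` is the second vertex. -/
theorem IsPathList.eq_of_adj (hT : T.IsAcyclic) {a b c : V} {l : List V}
    (h : IsPathList T (a :: c :: l)) (hb : b ∈ a :: c :: l) (hab : T.Adj a b) : b = c := by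
  by_contra hbc
  have hb' : b ∈ l := by
    have := hab.ne'
    simp_all
  obtain ⟨l1, l2, rfl⟩ := List.append_of_mem hb'
  have h1 : IsPathList T (a :: (c :: l1) ++ [b]) := h.infix ⟨[], l2, by simp⟩
  have h2 : IsPathList T (a :: [] ++ [b]) := ⟨by simpa using hab, by simpa using hab.ne⟩
  have := h1.unique' hT h2
  simp at this

theorem IsPathList.eq_or_eq_of_adj (hT : T.IsAcyclic) {a b c x : V} {l l' : List V}
    (h : IsPathList T (l ++ b :: a :: c :: l')) (hx : x ∈ l ++ b :: a :: c :: l')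
    (hax : T.Adj a x) : x = b ∨ x = c := by
  have h1 : IsPathList T (a :: c :: l') := h.infix ⟨l ++ [b], [], by simp⟩
  have h2 : IsPathList T (a :: b :: l.reverse) :=
    h.reverse.infix ⟨l'.reverse ++ [c], [], by simp⟩
  have : x ∈ a :: c :: l' ∨ x ∈ a :: b :: l.reverse := by
    simp at hx ⊢; tauto
  rcases this with h | h
  · exact Or.inr (h1.eq_of_adj hT h hax)
  · exact Or.inl (h2.eq_of_adj hT h hax)

/-- The vertex `a` is an end of the path with vertex set `W` iff it has at most one neighbour
in `W`. -/
theorem isPathEndingAt_iff (hT : T.IsAcyclic) {W : Set V} (hW : ∃ a, IsPathEndingAt T W a) {a : V} :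
    IsPathEndingAt T W a ↔
      a ∈ W ∧ ∀ b ∈ W, ∀ c ∈ W, T.Adj a b → T.Adj a c → b = c := by
  constructor
  · rw [isPathEndingAt_iff_list]
    rintro ⟨l, h, rfl⟩
    refine ⟨by simp, fun b hb c hc hab hac => ?_⟩
    cases l with
    | nil => simp at hb; exact absurd hb.symm hab.ne
    | cons d l => rw [h.eq_of_adj hT hb hab, h.eq_of_adj hT hc hac]
  · rintro ⟨ha, hbc⟩
    obtain ⟨l, -, hl, rfl⟩ := exists_isPathEndingAt_iff_list.1 hW
    obtain ⟨l1, l2, rfl⟩ := List.append_of_mem (show a ∈ l from ha)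
    rw [isPathEndingAt_iff_list]
    rcases List.eq_nil_or_concat' l1 with rfl | ⟨l1, b, rfl⟩
    · exact ⟨l2, hl, by simp⟩
    cases l2 with
    | nil => exact ⟨(l1 ++ [b]).reverse, by simpa using hl.reverse, by ext; simp; tauto⟩
    | cons c l2 =>
      exfalso
      have h3 : IsPathList T [b, a, c] := hl.infix ⟨l1, l2, by simp⟩
      have hbc := hbc b (by simp) c (by simp) (by simpa using h3.1.rel.symm)
        (by have := h3.1; simp at this; exact this.2)
      have := h3.2
      simp [hbc] at this

end Lists
/-! ### Adding a leaf to a tree, subdividing an edge of a tree -/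

section Trees

variable {V W : Type*}

/-- The map may contract an edge or stretch it to a walk; this transfers connectivity and bridges
between a tree and its modifications. -/
theorem reachable_of_adj_reachable {G : SimpleGraph V} {H : SimpleGraph W} (f : V → W)
    (hf : ∀ x y, G.Adj x y → H.Reachable (f x) (f y)) {a b : V} (h : G.Reachable a b) :
    H.Reachable (f a) (f b) := by
  obtain ⟨p⟩ := h
  induction p with
  | nil => exact SimpleGraph.Reachable.refl _
  | cons h _ ih => exact (hf _ _ h).trans ih

theorem isAcyclic_iff_not_reachable {G : SimpleGraph V} :
    G.IsAcyclic ↔ ∀ v w, G.Adj v w → ¬ (G.deleteEdges {s(v, w)}).Reachable v w := by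
  rw [SimpleGraph.isAcyclic_iff_forall_adj_isBridge]
  rfl

/-- The graph obtained from `T` by adding a leaf `none` attached at `a`. -/
def addLeaf (T : SimpleGraph V) (a : V) : SimpleGraph (Option V) where
  Adj
    | some x, some y => T.Adj x y
    | some x, none => x = a
    | none, some x => x = a
    | none, none => False
  symm := ⟨by rintro (_ | x) (_ | y) h <;> simp_all [T.adj_comm]⟩
  loopless := ⟨by rintro (_ | x) h <;> simp_all⟩

/-- The graph obtained from `T` by inserting a new vertex `none` in the middle of the
edge `st`. -/
def subdivide (T : SimpleGraph V) (s t : V) : SimpleGraph (Option V) where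
  Adj
    | some x, some y => T.Adj x y ∧ s(x, y) ≠ s(s, t)
    | some x, none => x = s ∨ x = t
    | none, some x => x = s ∨ x = t
    | none, none => False
  symm := ⟨by
    rintro (_ | x) (_ | y) h
    · exact h
    · exact h
    · exact h
    · exact ⟨h.1.symm, by rw [Sym2.eq_swap]; exact h.2⟩⟩
  loopless := ⟨by rintro (_ | x) h <;> simp_all⟩

theorem isTree_addLeaf {T : SimpleGraph V} (hT : T.IsTree) (a : V) : (addLeaf T a).IsTree := by
  have hsome : ∀ x y, (addLeaf T a).Reachable (some x) (some y) := fun x y =>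
    reachable_of_adj_reachable some (fun x y h => SimpleGraph.Adj.reachable h)
      (hT.connected.preconnected x y)
  have hnone : (addLeaf T a).Adj (some a) none := rfl
  refine ⟨⟨?_⟩, ?_⟩
  · have : ∀ x, (addLeaf T a).Reachable x none := by
      rintro (_ | x)
      · exact SimpleGraph.Reachable.refl _
      · exact (hsome x a).trans hnone.reachable
    exact fun x y => (this x).trans (this y).symm
  · rw [isAcyclic_iff_not_reachable]
    -- Once the leaf edge is deleted, `Option.isSome` is constant along edges.
    have hn : ¬ ((addLeaf T a).deleteEdges {s(some a, none)}).Reachable none (some a) := by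
      intro h
      have := reachable_of_adj_reachable (H := (⊥ : SimpleGraph Bool)) Option.isSome ?_ h
      · simp at this
      · rintro (_ | x) (_ | y) h
        · simp
        · simp [addLeaf] at h
        · simp [addLeaf] at h
        · simp
    rintro (_ | x) (_ | y) h
    · exact h.elim
    · obtain rfl : y = a := h
      rw [Sym2.eq_swap]
      exact hn
    · obtain rfl : x = a := h
      exact fun h => hn h.symm
    · intro h'
      refine isAcyclic_iff_not_reachable.1 hT.isAcyclic x y h
        (reachable_of_adj_reachable (fun z => z.getD a) ?_ h')
      rintro (_ | z) (_ | w) h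
      · simp
      · have : w = a := h.1
        simp [this]
      · have : z = a := h.1
        simp [this]
      · refine SimpleGraph.Adj.reachable ?_
        rw [SimpleGraph.deleteEdges_adj] at h ⊢
        exact ⟨h.1, by simpa using h.2⟩

theorem isTree_subdivide {T : SimpleGraph V} (hT : T.IsTree) {s t : V} (hst : T.Adj s t) :
    (subdivide T s t).IsTree := by
  have hs : (subdivide T s t).Adj (some s) none := Or.inl rfl
  have ht : (subdivide T s t).Adj (some t) none := Or.inr rfl
  have hsome : ∀ x y, (subdivide T s t).Reachable (some x) (some y) := fun x y =>
    reachable_of_adj_reachable some (fun x y h => by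
      by_cases he : s(x, y) = s(s, t)
      · rcases Sym2.eq_iff.1 he with ⟨rfl, rfl⟩ | ⟨rfl, rfl⟩
        · exact hs.reachable.trans ht.reachable.symm
        · exact ht.reachable.trans hs.reachable.symm
      · exact SimpleGraph.Adj.reachable ⟨h, he⟩) (hT.connected.preconnected x y)
  have hacyc := isAcyclic_iff_not_reachable.1 hT.isAcyclic
  refine ⟨⟨?_⟩, ?_⟩
  · have : ∀ x, (subdivide T s t).Reachable x none := by
      rintro (_ | x)
      · exact SimpleGraph.Reachable.refl _
      · exact (hsome x s).trans hs.reachable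
    exact fun x y => (this x).trans (this y).symm
  · rw [isAcyclic_iff_not_reachable]
    -- Contracting `none` onto `t` would give a walk from `s` to `t` avoiding the bridge `st`.
    have hns : ¬ ((subdivide T s t).deleteEdges {s(some s, none)}).Reachable (some s) none := by
      intro h
      refine hacyc s t hst (reachable_of_adj_reachable (fun z => z.getD t) ?_ h)
      rintro (_ | z) (_ | w) h
      · simp
      · rcases h.1 with rfl | rfl
        · exact absurd h.2 (by simp)
        · simp
      · rcases h.1 with rfl | rfl
        · exact absurd h.2 (by simp)
        · simp
      · exact SimpleGraph.Adj.reachable (SimpleGraph.deleteEdges_adj.2 h.1)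
    have hnt : ¬ ((subdivide T s t).deleteEdges {s(some t, none)}).Reachable (some t) none := by
      intro h
      refine hacyc s t hst (reachable_of_adj_reachable (fun z => z.getD s) ?_ h).symm
      rintro (_ | z) (_ | w) h
      · simp
      · rcases h.1 with rfl | rfl
        · simp
        · exact absurd h.2 (by simp)
      · rcases h.1 with rfl | rfl
        · simp
        · exact absurd h.2 (by simp)
      · exact SimpleGraph.Adj.reachable (SimpleGraph.deleteEdges_adj.2 h.1)
    rintro (_ | x) (_ | y) h
    · exact h.elim
    · rw [Sym2.eq_swap]
      rcases h with rfl | rfl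
      · exact fun h => hns h.symm
      · exact fun h => hnt h.symm
    · rcases h with rfl | rfl
      · exact hns
      · exact hnt
    · intro h'
      -- Contracting `none` onto `s` restores the edge `st`, which is not the deleted edge `xy`.
      refine hacyc x y h.1 (reachable_of_adj_reachable (fun z => z.getD s) ?_ h')
      have hts : (T.deleteEdges {s(x, y)}).Adj t s :=
        SimpleGraph.deleteEdges_adj.2 ⟨hst.symm, by
          rw [Set.mem_singleton_iff, Sym2.eq_swap]; exact fun h' => h.2 (Eq.symm h')⟩
      rintro (_ | z) (_ | w) h
      · simp
      · rcases h.1 with rfl | rfl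
        · simp
        · exact hts.reachable.symm
      · rcases h.1 with rfl | rfl
        · simp
        · exact hts.reachable
      · refine SimpleGraph.Adj.reachable ?_
        rw [SimpleGraph.deleteEdges_adj] at h ⊢
        exact ⟨h.1.1, by simpa using h.2⟩

theorem IsPathList.addLeaf {T : SimpleGraph V} {l : List V} (h : IsPathList T l) (a : V) :
    IsPathList (addLeaf T a) (l.map some) :=
  ⟨List.isChain_map_of_isChain some (fun _ _ h => h) h.1, h.2.map (Option.some_injective V)⟩

theorem IsPathList.subdivide {T : SimpleGraph V} {l : List V} (h : IsPathList T l) {s t : V}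
    (hst : ¬ (s ∈ l ∧ t ∈ l)) : IsPathList (subdivide T s t) (l.map some) := by
  refine ⟨?_, h.2.map (Option.some_injective V)⟩
  rw [List.isChain_map]
  refine h.1.imp_of_mem_imp fun x y hx hy hxy => ⟨hxy, fun he => hst ?_⟩
  rcases Sym2.eq_iff.1 he with ⟨rfl, rfl⟩ | ⟨rfl, rfl⟩
  · exact ⟨hx, hy⟩
  · exact ⟨hy, hx⟩

theorem IsPathList.subdivide_append {T : SimpleGraph V} {l l' : List V} {s t : V}
    (h : IsPathList T (l ++ s :: t :: l')) :
    IsPathList (CPT.subdivide T s t) (l.map some ++ some s :: none :: some t :: l'.map some) := by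
  have hn := h.2
  have h1 := (h.infix (l' := l ++ [s]) ⟨[], t :: l', by simp⟩).subdivide (s := s) (t := t)
    (by simp [List.nodup_append] at hn ⊢; grind)
  have h2 := (h.infix (l' := t :: l') ⟨l ++ [s], [], by simp⟩).subdivide (s := s) (t := t)
    (by simp [List.nodup_append] at hn ⊢; grind)
  constructor
  · have : l.map some ++ some s :: none :: some t :: l'.map some =
      (l ++ [s]).map some ++ none :: (t :: l').map some := by simp
    rw [this, List.isChain_append]
    refine ⟨h1.1, ?_, ?_⟩
    · rw [List.isChain_cons]
      refine ⟨?_, h2.1⟩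
      simp [CPT.subdivide]
    · simp [CPT.subdivide]
  · have := hn.map (Option.some_injective V)
    have e : (l.map some ++ some s :: none :: some t :: l'.map some).Perm
        (none :: (l ++ s :: t :: l').map some) := by
      have : l.map some ++ some s :: none :: some t :: l'.map some =
      (l ++ [s]).map some ++ none :: (t :: l').map some := by simp
      rw [this]
      refine List.perm_middle.trans ?_
      simp
    rw [e.nodup_iff]
    simpa using this

end Trees
/-! ### Modifying representations -/

namespace Rep

variable {X : Type*} [PartialOrder X]

theorem le_iff (R : Rep X) (x y : X) : x ≤ y ↔ R.path x ⊆ R.path y := by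
  rw [le_iff_lt_or_eq, R.lt_iff, subset_iff_ssubset_or_eq, R.injective.eq_iff]

/-- A representation built from an order embedding into paths ordered by inclusion. -/
def ofLe (V : Type) [Finite V] (T : SimpleGraph V) (hT : T.IsTree) (path : X → Set V)
    (isPath : ∀ x, ∃ l, l ≠ [] ∧ IsPathList T l ∧ path x = {w | w ∈ l})
    (hle : ∀ x y, x ≤ y ↔ path x ⊆ path y) : Rep X where
  V := V
  finite_V := inferInstance
  T := T
  isTree := hT
  path := path
  isPath x := exists_isPathEndingAt_iff_list.2 (isPath x)
  injective x y h := le_antisymm ((hle x y).2 h.subset) ((hle y x).2 h.symm.subset)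
  lt_iff x y := by rw [lt_iff_le_not_ge, hle, hle]; rfl

theorem exists_list (R : Rep X) (x : X) :
    ∃ l, l ≠ [] ∧ IsPathList R.T l ∧ R.path x = {w | w ∈ l} :=
  exists_isPathEndingAt_iff_list.1 (R.isPath x)

theorem endsAt_iff (R : Rep X) {x : X} {a : R.V} : R.EndsAt x a ↔
    a ∈ R.path x ∧ ∀ b ∈ R.path x, ∀ c ∈ R.path x, R.T.Adj a b → R.T.Adj a c → b = c :=
  isPathEndingAt_iff R.isTree.isAcyclic (R.isPath x)

theorem path_nonempty (R : Rep X) (x : X) : (R.path x).Nonempty := by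
  obtain ⟨l, h0, -, h⟩ := R.exists_list x
  obtain ⟨a, ha⟩ := List.exists_mem_of_ne_nil l h0
  exact ⟨a, h ▸ ha⟩

theorem convex (R : Rep X) {x : X} {k : List R.V} {s t : R.V} (hs : s ∈ R.path x)
    (ht : t ∈ R.path x) (hk : IsPathList R.T (s :: k ++ [t])) : ∀ w ∈ s :: k ++ [t], w ∈ R.path x := by
  obtain ⟨l, -, hl, h⟩ := R.exists_list x
  rw [h] at hs ht ⊢
  exact convex_of_isPathList R.isTree.isAcyclic hl hs ht hk

/-- If the path of `x` ends on the trivial path of `z`, then `z ≤ x`. -/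
theorem EndsOnTrivial.le {R : Rep X} {x z : X} (h : R.EndsOnTrivial x z) : z ≤ x := by
  obtain ⟨a, hz, hx⟩ := h
  rw [R.le_iff, hz, Set.singleton_subset_iff]
  exact (R.endsAt_iff.1 hx).1

theorem image_some_union_subset {V : Type*} {A B : Set V} {p q : Prop} (h : A ⊆ B → p → q) :
    some '' A ∪ {v | v = none ∧ p} ⊆ some '' B ∪ {v | v = none ∧ q} ↔ A ⊆ B := by
  constructor
  · intro h a ha
    simpa using h (Or.inl ⟨a, ha, rfl⟩)
  · rintro hAB _ (⟨a, ha, rfl⟩ | ⟨rfl, hp⟩)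
    · exact Or.inl ⟨a, hAB ha, rfl⟩
    · exact Or.inr ⟨rfl, h hAB hp⟩

/-- Adding a leaf to the host tree. -/
theorem exists_addLeaf (R : Rep X) (a : R.V) :
    ∃ (R' : Rep X) (f : R.V → R'.V) (w : R'.V), Function.Injective f ∧ w ∉ Set.range f ∧
      R'.T.Adj (f a) w ∧ (∀ l, IsPathList R.T l → IsPathList R'.T (l.map f)) ∧
      (∀ x, R'.path x = f '' R.path x) ∧
      ∀ x z, R'.EndsOnTrivial x z → R.EndsOnTrivial x z := by
  have := R.finite_V
  let R' : Rep X := ofLe (Option R.V) (addLeaf R.T a) (isTree_addLeaf R.isTree a)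
    (fun x => some '' R.path x)
    (fun x => by
      obtain ⟨l, h0, hl, h⟩ := R.exists_list x
      exact ⟨l.map some, by simpa using h0, hl.addLeaf a, by rw [h]; ext; simp⟩)
    (fun x y => by
      rw [R.le_iff, Set.image_subset_image_iff (Option.some_injective _)])
  refine ⟨R', some, none, Option.some_injective _,
    fun ⟨_, h⟩ => Option.some_ne_none _ h, rfl, fun l h => h.addLeaf a,
    fun x => rfl, ?_⟩
  rintro x z ⟨b, hz, hx⟩
  obtain ⟨hb, hbc⟩ := R'.endsAt_iff.1 hx
  obtain ⟨b, hb, rfl⟩ := hb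
  refine ⟨b, ?_, R.endsAt_iff.2 ⟨hb, fun c hc d hd hbc' hbd => ?_⟩⟩
  · have : some '' R.path z = some '' {b} := by rw [Set.image_singleton]; exact hz
    exact (Option.some_injective _).image_injective this
  · exact Option.some_injective _ (hbc _ ⟨c, hc, rfl⟩ _ ⟨d, hd, rfl⟩ hbc' hbd)

/-- Subdividing an edge of the host tree by one vertex. -/
theorem exists_subdivide (R : Rep X) {s t : R.V} (hst : R.T.Adj s t) :
    ∃ (R' : Rep X) (f : R.V → R'.V) (w : R'.V), Function.Injective f ∧ w ∉ Set.range f ∧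
      (∀ l l', IsPathList R.T (l ++ s :: t :: l') →
        IsPathList R'.T (l.map f ++ f s :: w :: f t :: l'.map f)) ∧
      (∀ x, R'.path x = f '' R.path x ∪ {v | v = w ∧ s ∈ R.path x ∧ t ∈ R.path x}) ∧
      ∀ x z, R'.EndsOnTrivial x z → R.EndsOnTrivial x z := by
  have := R.finite_V
  let R' : Rep X := ofLe (Option R.V) (subdivide R.T s t) (isTree_subdivide R.isTree hst)
    (fun x => some '' R.path x ∪ {v | v = none ∧ s ∈ R.path x ∧ t ∈ R.path x})
    (fun x => by
      obtain ⟨l, h0, hl, h⟩ := R.exists_list x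
      rw [h]
      by_cases hm : s ∈ l ∧ t ∈ l
      · have hk : IsPathList R.T (s :: [] ++ [t]) := ⟨by simpa using hst, by simpa using hst.ne⟩
        have key : ∃ l1 l2, IsPathList R.T (l1 ++ s :: t :: l2) ∧
            ∀ v, v ∈ l ↔ v ∈ l1 ++ s :: t :: l2 := by
          rcases hl.subset_of_ends R.isTree.isAcyclic hm.1 hm.2 hk with ⟨l1, l2, h⟩ | ⟨l1, l2, h⟩
          · have h : l1 ++ s :: t :: l2 = l := by simpa using h
            exact ⟨l1, l2, h ▸ hl, by simp [← h]⟩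
          · have h : l1 ++ s :: t :: l2 = l.reverse := by simpa using h
            exact ⟨l1, l2, h ▸ hl.reverse, by simp [h]⟩
        obtain ⟨l1, l2, hp, hv⟩ := key
        refine ⟨_, by simp, hp.subdivide_append, ?_⟩
        ext v
        cases v
        · simpa using hm
        · simp [hv]
      · refine ⟨l.map some, by simpa using h0, hl.subdivide hm, ?_⟩
        ext v
        cases v <;> simp
        tauto)
    (fun x y => by
      rw [R.le_iff, image_some_union_subset]
      exact fun h h' => ⟨h h'.1, h h'.2⟩)
  refine ⟨R', some, none, Option.some_injective _,
    fun ⟨_, h⟩ => Option.some_ne_none _ h, fun l l' h => h.subdivide_append,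
    fun x => rfl, ?_⟩
  rintro x z ⟨b, hz, hx⟩
  have hzb : R'.path z = some '' R.path z ∪ {v | v = none ∧ s ∈ R.path z ∧ t ∈ R.path z} := rfl
  obtain ⟨c, hc⟩ := R.path_nonempty z
  have hcb : some c = b := by
    have : some c ∈ R'.path z := Or.inl ⟨c, hc, rfl⟩
    rwa [hz] at this
  subst hcb
  obtain ⟨hb, hbc⟩ := R'.endsAt_iff.1 hx
  replace hb : c ∈ R.path x := by
    rcases hb with ⟨_, h, h'⟩ | ⟨h, -⟩
    · exact Option.some_injective _ h' ▸ h
    · exact absurd h (by simp)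
  refine ⟨c, ?_, R.endsAt_iff.2 ⟨hb, fun d hd e he hcd hce => ?_⟩⟩
  · refine Set.eq_singleton_iff_unique_mem.2 ⟨hc, fun d hd => ?_⟩
    have : some d ∈ R'.path z := Or.inl ⟨d, hd, rfl⟩
    rw [hz] at this
    exact Option.some_injective _ this
  · have hmem : ∀ d ∈ R.path x, (some d : Option R.V) ∈ R'.path x := fun d hd => Or.inl ⟨d, hd, rfl⟩
    -- If `d` lies across the subdivided edge, `none` replaces it as the neighbour of `c`; so
    -- distinct old neighbours of `c` on the path yield distinct new ones.
    have hsub : ∀ d ∈ R.path x, s(c, d) = s(s, t) →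
        (none : Option R.V) ∈ R'.path x ∧ R'.T.Adj (some c) none := by
      intro d hd h
      rcases Sym2.eq_iff.1 h with ⟨rfl, rfl⟩ | ⟨rfl, rfl⟩
      · exact ⟨Or.inr ⟨rfl, hb, hd⟩, Or.inl rfl⟩
      · exact ⟨Or.inr ⟨rfl, hd, hb⟩, Or.inr rfl⟩
    by_cases h1 : s(c, d) = s(s, t) <;> by_cases h2 : s(c, e) = s(s, t)
    · exact Sym2.congr_right.1 (h1.trans h2.symm)
    · have := hbc _ (hsub d hd h1).1 _ (hmem e he) (hsub d hd h1).2 ⟨hce, h2⟩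
      simp at this
    · have := hbc _ (hmem d hd) _ (hsub e he h2).1 ⟨hcd, h1⟩ (hsub e he h2).2
      simp at this
    · exact Option.some_injective _ (hbc _ (hmem d hd) _ (hmem e he) ⟨hcd, h1⟩ ⟨hce, h2⟩)

/-- Subdividing an edge of the host tree by several vertices. -/
theorem exists_subdivide_list (n : ℕ) : ∀ (R : Rep X) {u t : R.V} {l : List R.V},
    IsPathList R.T (u :: t :: l) →
    ∃ (R' : Rep X) (f : R.V → R'.V) (P : List R'.V), Function.Injective f ∧ P.length = n ∧
      (∀ p ∈ P, p ∉ Set.range f) ∧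
      IsPathList R'.T (f u :: P ++ (t :: l).map f) ∧
      (∀ x, R'.path x = f '' R.path x ∪ {p | p ∈ P ∧ u ∈ R.path x ∧ t ∈ R.path x}) ∧
      ∀ x z, R'.EndsOnTrivial x z → R.EndsOnTrivial x z := by
  induction n with
  | zero =>
    intro R u t l h
    exact ⟨R, id, [], Function.injective_id, rfl, by simp, by simpa using h, by simp,
      fun _ _ h => h⟩
  | succ n ih =>
    intro R u t l h
    obtain ⟨R1, f, w, hf, hw, hl, hp, hE⟩ := R.exists_subdivide h.1.rel
    -- The edge at `u` is subdivided again, with `w` in the role of `t`: a path contains `u` and `w`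
    -- iff it contained `u` and `t`.
    obtain ⟨R2, g, P, hg, hP, hPg, hl2, hp2, hE2⟩ := ih R1 (hl [] l h)
    refine ⟨R2, g ∘ f, P ++ [g w], hg.comp hf, by simp [hP], ?_, ?_, ?_,
      fun x z h => hE x z (hE2 x z h)⟩
    · intro p hp'
      rcases List.mem_append.1 hp' with h | h
      · rintro ⟨a, rfl⟩
        exact hPg _ h ⟨f a, rfl⟩
      · rw [List.mem_singleton.1 h]
        rintro ⟨a, ha⟩
        exact hw ⟨a, hg ha⟩
    · simpa using hl2
    · intro x
      have hu : f u ∈ R1.path x ↔ u ∈ R.path x := by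
        rw [hp]
        simp only [Set.mem_union, hf.mem_set_image, Set.mem_ofPred_eq, or_iff_left_iff_imp]
        rintro ⟨h, -⟩
        exact absurd ⟨u, h⟩ hw
      have hw' : w ∈ R1.path x ↔ u ∈ R.path x ∧ t ∈ R.path x := by
        rw [hp]
        simp only [Set.mem_union, Set.mem_ofPred_eq, true_and, or_iff_right_iff_imp]
        rintro ⟨a, -, h⟩
        exact absurd ⟨a, h⟩ hw
      rw [hp2, hu, hw', hp]
      ext v
      simp only [Set.image_union, Set.mem_union, Set.mem_ofPred_eq, List.mem_append,
        List.mem_singleton, Set.image_comp]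
      constructor
      · rintro ((h | ⟨_, ⟨rfl, h⟩, rfl⟩) | h)
        · exact Or.inl h
        · exact Or.inr ⟨Or.inr rfl, h⟩
        · exact Or.inr ⟨Or.inl h.1, h.2.2⟩
      · rintro (h | ⟨h | rfl, h'⟩)
        · exact Or.inl (Or.inl h)
        · exact Or.inr ⟨h, h'.1, h'⟩
        · exact Or.inl (Or.inr ⟨w, ⟨rfl, h'⟩, rfl⟩)

end Rep
-- Intersections of paths in a forest
section Lists

variable {V : Type*} {T : SimpleGraph V}

theorem exists_first_of_mem {l : List V} {p : V → Prop} (h : ∃ x ∈ l, p x) :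
    ∃ l1 s l2, l = l1 ++ s :: l2 ∧ p s ∧ ∀ x ∈ l1, ¬ p x := by
  induction l with
  | nil => simp at h
  | cons a l ih =>
    by_cases ha : p a
    · exact ⟨[], a, l, rfl, ha, by simp⟩
    · obtain ⟨l1, s, l2, rfl, hs, h1⟩ := ih (by simpa [ha] using h)
      exact ⟨a :: l1, s, l2, rfl, hs, by simpa [ha] using h1⟩

/-- In a forest, paths that meet intersect in a path. -/
theorem exists_isPathList_inter (hT : T.IsAcyclic) {l k : List V} (hl : IsPathList T l)
    (hk : IsPathList T k) (h : ∃ x ∈ l, x ∈ k) :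
    ∃ l', l' ≠ [] ∧ l' <:+: l ∧ ∀ x, x ∈ l' ↔ x ∈ l ∧ x ∈ k := by
  obtain ⟨l1, s, l2, rfl, hs, h1⟩ := exists_first_of_mem h
  -- `s` and `t` are the first and last vertices of `l` lying in `k`; convexity of `k` fills the gap
  -- between them.
  obtain ⟨r1, t, r2, hr, ht, h2⟩ := exists_first_of_mem (l := (s :: l2).reverse) (p := (· ∈ k))
    ⟨s, by simp, hs⟩
  have hr' : s :: l2 = r2.reverse ++ t :: r1.reverse := by
    rw [← List.reverse_reverse (s :: l2), hr]; simp
  rw [hr'] at hl ⊢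
  refine ⟨r2.reverse ++ [t], by simp, ⟨l1, r1.reverse, by simp⟩, fun x => ?_⟩
  have hsub : ∀ x ∈ r2.reverse ++ [t], x ∈ k := by
    rcases hr2 : r2.reverse with _ | ⟨s', r⟩
    · simpa using ht
    · rw [hr2] at hr' hl
      obtain rfl : s = s' := by simpa using congrArg List.head? hr'
      exact convex_of_isPathList hT hk hs ht (hl.infix ⟨l1, r1.reverse, by simp⟩)
  constructor
  · intro hx
    refine ⟨?_, hsub x hx⟩
    simp at hx ⊢; tauto
  · rintro ⟨hx, hxk⟩
    have a1 : x ∉ l1 := fun h => h1 x h hxk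
    have a2 : x ∉ r1 := fun h => h2 x h hxk
    simp at hx ⊢; tauto

theorem getElem_mem_take_iff {l : List V} (hl : l.Nodup) {i n : ℕ} (hi : i < l.length) :
    l[i] ∈ l.take n ↔ i < n := by
  rw [List.mem_take_iff_getElem]
  constructor
  · rintro ⟨j, hj, h⟩
    have := (hl.getElem_inj_iff).1 h
    omega
  · intro h
    exact ⟨i, by omega, rfl⟩

end Lists

/-! ### Spreading a module along a path -/

/-- The elements outside `M` below all the elements of `M`. -/
def lowerOf {X : Type*} [PartialOrder X] (M : Set X) : Set X := {x | x ∉ M ∧ ∀ m ∈ M, x < m}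

/-- The elements outside `M` above all the elements of `M`. -/
def upperOf {X : Type*} [PartialOrder X] (M : Set X) : Set X := {x | x ∉ M ∧ ∀ m ∈ M, m < x}

/-- Every element outside `M` is below all, above all, or incomparable to all elements of `M`. -/
def IsOrderModule {X : Type*} [PartialOrder X] (M : Set X) : Prop :=
  ∀ x, x ∉ M → x ∈ lowerOf M ∨ x ∈ upperOf M ∨ ∀ m ∈ M, ¬ m < x ∧ ¬ x < m

namespace Rep

variable {X : Type*} [PartialOrder X]

open Classical in
/-- The path of `x` after the module `M` has been spread along the path `A.reverse ++ K ++ B`. -/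
def spreadPath (R : Rep X) (M : Set X) (A K B : List R.V) (a b : X → ℕ) (x : X) : Set R.V :=
  if x ∈ M then {w | w ∈ (A.take (a x + 1)).reverse ++ K ++ B.take (b x + 1)}
  else if x ∈ lowerOf M then {w | w ∈ K ∧ w ∈ R.path x}
  else R.path x

/-- Module paths contain the core `K` and reach into `A` and `B` according to two coordinates, so
inclusion among them is the product order. Lower paths are cut down to `K`; by `hL2` their trace on
`K` still determines which outside paths contain them. `hI` and `hI'` forbid accidental inclusions
with the other paths. `hL3` puts both neighbours of a trivial lower path inside `K`, so no module
path can end there. -/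
theorem exists_spread (R : Rep X) {M : Set X} (hM : IsOrderModule M)
    {A K B : List R.V} {u v : R.V} {a b : X → ℕ}
    (hab : ∀ x ∈ M, ∀ y ∈ M, x ≤ y ↔ a x ≤ a y ∧ b x ≤ b y)
    (ha : ∀ x ∈ M, a x < A.length) (hb : ∀ x ∈ M, b x < B.length)
    (hQ : IsPathList R.T (u :: (A.reverse ++ K ++ B) ++ [v]))
    (hU : ∀ x ∈ upperOf M, ∀ w ∈ u :: (A.reverse ++ K ++ B) ++ [v], w ∈ R.path x)
    (hL : ∀ x ∈ lowerOf M, ∀ w ∈ R.path x, w ∈ u :: (A.reverse ++ K ++ B) ++ [v])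
    (hL1 : ∀ x ∈ lowerOf M, ∃ w ∈ K, w ∈ R.path x)
    (hL2 : ∀ x ∈ lowerOf M, ∀ y, y ∉ M → (∀ w ∈ K, w ∈ R.path x → w ∈ R.path y) →
      R.path x ⊆ R.path y)
    (hL3 : ∀ x ∈ lowerOf M, ∀ w, (∀ w', w' ∈ K ∧ w' ∈ R.path x ↔ w' = w) → R.path x = {w} ∧
      ∃ k1 c d k2, K = k1 ++ c :: w :: d :: k2)
    (hI : ∀ x, x ∉ M → x ∉ lowerOf M → ¬ ∀ w ∈ R.path x, w ∈ A.reverse ++ K ++ B)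
    (hI' : ∀ x, x ∉ M → x ∉ lowerOf M → x ∉ upperOf M → ¬ ∀ w ∈ K, w ∈ R.path x) :
    ∃ R' : Rep X, (∀ m ∈ M, ∀ z, ¬ R'.EndsOnTrivial m z) ∧
      ∀ x z, R'.EndsOnTrivial x z → R.EndsOnTrivial x z := by
  classical
  have hfin := R.finite_V
  have hT := R.isTree.isAcyclic
  have hpM : ∀ x ∈ M, R.spreadPath M A K B a b x =
      {w | w ∈ (A.take (a x + 1)).reverse ++ K ++ B.take (b x + 1)} := fun x hx => by
    simp [spreadPath, hx]
  have hpL : ∀ x ∈ lowerOf M, R.spreadPath M A K B a b x = {w | w ∈ K ∧ w ∈ R.path x} :=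
    fun x hx => by rw [spreadPath, if_neg hx.1, if_pos hx]
  have hpI : ∀ x, x ∉ M → x ∉ lowerOf M → R.spreadPath M A K B a b x = R.path x :=
    fun x h h' => by rw [spreadPath, if_neg h, if_neg h']
  have hn := hQ.2
  have hnA : A.Nodup := by simp [List.nodup_append] at hn; tauto
  have hnB : B.Nodup := by simp [List.nodup_append] at hn; tauto
  have hAK : ∀ w ∈ A, w ∉ K := by simp [List.nodup_append] at hn; grind
  have hAB : ∀ w ∈ A, w ∉ B := by simp [List.nodup_append] at hn; grind
  have hKB : ∀ w ∈ B, w ∉ K := by simp [List.nodup_append] at hn; grind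
  have hsub : ∀ x ∈ M, ∀ w ∈ (A.take (a x + 1)).reverse ++ K ++ B.take (b x + 1),
      w ∈ A.reverse ++ K ++ B := by
    intro x _ w hw
    simp only [List.mem_append, List.mem_reverse] at hw ⊢
    rcases hw with (h | h) | h
    · exact Or.inl (Or.inl (List.mem_of_mem_take h))
    · exact Or.inl (Or.inr h)
    · exact Or.inr (List.mem_of_mem_take h)
  have hmid : ∀ w ∈ A.reverse ++ K ++ B, w ∈ u :: (A.reverse ++ K ++ B) ++ [v] := by
    intro w hw; simp at hw ⊢; tauto
  have hLM : ∀ x ∈ lowerOf M, ∀ y, y ∉ M → y ≤ x → y ∈ lowerOf M :=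
    fun x hx y hy hyx => ⟨hy, fun m hm => hyx.trans_lt (hx.2 m hm)⟩
  have hle : ∀ x y, x ≤ y ↔ R.spreadPath M A K B a b x ⊆ R.spreadPath M A K B a b y := by
    intro x y
    by_cases hx : x ∈ M
    · have hAx := ha x hx
      have hBx := hb x hx
      -- The outermost vertices `A[a x]` and `B[b x]` of the new path recover the two coordinates
      -- under inclusion.
      have hAmem : A[a x] ∈ R.spreadPath M A K B a b x := by
        rw [hpM x hx]
        have := (getElem_mem_take_iff hnA (n := a x + 1) hAx).2 (by omega)
        simp [this]
      have hBmem : B[b x] ∈ R.spreadPath M A K B a b x := by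
        rw [hpM x hx]
        have := (getElem_mem_take_iff hnB (n := b x + 1) hBx).2 (by omega)
        simp [this]
      by_cases hy : y ∈ M
      · rw [hab x hx y hy]
        constructor
        · rintro ⟨h1, h2⟩ w hw
          rw [hpM x hx] at hw
          rw [hpM y hy]
          simp only [Set.mem_ofPred_eq, List.mem_append, List.mem_reverse] at hw ⊢
          rcases hw with (h | h) | h
          · exact Or.inl (Or.inl (List.take_subset_take_left _ (by omega) h))
          · exact Or.inl (Or.inr h)
          · exact Or.inr (List.take_subset_take_left _ (by omega) h)
        · intro h
          have h1 := h hAmem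
          have h2 := h hBmem
          rw [hpM y hy] at h1 h2
          simp only [Set.mem_ofPred_eq, List.mem_append, List.mem_reverse] at h1 h2
          constructor
          · rcases h1 with (h | h) | h
            · have := (getElem_mem_take_iff hnA hAx).1 h
              omega
            · exact absurd h (hAK _ (List.getElem_mem _))
            · exact absurd (List.mem_of_mem_take h) (hAB _ (List.getElem_mem _))
          · rcases h2 with (h | h) | h
            · exact absurd (List.getElem_mem hBx) (hAB _ (List.mem_of_mem_take h))
            · exact absurd h (hKB _ (List.getElem_mem _))
            · have := (getElem_mem_take_iff hnB hBx).1 h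
              omega
      · by_cases hyL : y ∈ lowerOf M
        · refine iff_of_false (hyL.2 x hx).not_ge fun h => ?_
          have := h hAmem
          rw [hpL y hyL] at this
          exact hAK _ (List.getElem_mem _) this.1
        · rw [hpI y hy hyL, hpM x hx]
          by_cases hyU : y ∈ upperOf M
          · refine iff_of_true (hyU.2 x hx).le fun w hw => hU y hyU w (hmid w (hsub x hx w hw))
          · refine iff_of_false (fun h => ?_) fun h => ?_
            · rcases hM y hy with h' | h' | h'
              · exact hyL h'
              · exact hyU h'
              · exact (h' x hx).1 (lt_of_le_of_ne h (by rintro rfl; exact hy hx))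
            · exact hI' y hy hyL hyU fun w hw => h (by simp [hw])
    · by_cases hxL : x ∈ lowerOf M
      · rw [hpL x hxL]
        by_cases hy : y ∈ M
        · rw [hpM y hy]
          exact iff_of_true (hxL.2 y hy).le fun w hw => by simp [hw.1]
        · have key : x ≤ y ↔ ∀ w ∈ K, w ∈ R.path x → w ∈ R.path y :=
            ⟨fun h w _ hw => (R.le_iff x y).1 h hw, fun h => (R.le_iff x y).2 (hL2 x hxL y hy h)⟩
          rw [key]
          by_cases hyL : y ∈ lowerOf M
          · rw [hpL y hyL]
            exact ⟨fun h w hw => ⟨hw.1, h w hw.1 hw.2⟩, fun h w hw hw' => (h ⟨hw, hw'⟩).2⟩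
          · rw [hpI y hy hyL]
            exact ⟨fun h w hw => h w hw.1 hw.2, fun h w hw hw' => h ⟨hw, hw'⟩⟩
      · rw [hpI x hx hxL]
        by_cases hy : y ∈ M
        · rw [hpM y hy]
          refine iff_of_false (fun h => ?_) fun h => ?_
          · have hlt : x < y := lt_of_le_of_ne h (by rintro rfl; exact hx hy)
            rcases hM x hx with h' | h' | h'
            · exact hxL h'
            · exact (h'.2 y hy).not_ge h
            · exact (h' y hy).2 hlt
          · exact hI x hx hxL fun w hw => hsub y hy w (h hw)
        · by_cases hyL : y ∈ lowerOf M
          · rw [hpL y hyL]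
            refine iff_of_false (fun h => hxL (hLM y hyL x hx h)) fun h =>
              hxL (hLM y hyL x hx ((R.le_iff x y).2 fun w hw => (h hw).2))
          · rw [hpI y hy hyL]
            exact R.le_iff x y
  let R' : Rep X := ofLe R.V R.T R.isTree (R.spreadPath M A K B a b) (by
    intro x
    by_cases hx : x ∈ M
    · rw [hpM x hx]
      refine ⟨_, ?_, hQ.infix ?_, rfl⟩
      · intro h
        have h1 := ha x hx
        have h2 := congrArg List.length h
        simp only [List.length_append, List.length_reverse, List.length_take,
          List.length_nil] at h2
        omega
      · refine ⟨u :: (A.drop (a x + 1)).reverse, B.drop (b x + 1) ++ [v], ?_⟩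
        have e1 : (A.drop (a x + 1)).reverse ++ (A.take (a x + 1)).reverse = A.reverse := by
          rw [← List.reverse_append, List.take_append_drop]
        have e2 := List.take_append_drop (b x + 1) B
        conv_rhs => rw [← e1, ← e2]
        simp only [List.append_assoc, List.cons_append, List.take_append_drop]
        rw [← List.append_assoc (List.take _ B), e2]
    · by_cases hxL : x ∈ lowerOf M
      · obtain ⟨l, -, hl, h⟩ := R.exists_list x
        rw [hpL x hxL, h]
        obtain ⟨w, hw, hw'⟩ := hL1 x hxL
        obtain ⟨l', h0, hl', h'⟩ := exists_isPathList_inter hT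
          (hQ.infix (l' := K) ⟨u :: A.reverse, B ++ [v], by simp⟩) hl ⟨w, hw, by rwa [h] at hw'⟩
        exact ⟨l', h0, hQ.infix (hl'.trans ⟨u :: A.reverse, B ++ [v], by simp⟩), by ext w; simp [h']⟩
      · rw [hpI x hx hxL]
        exact R.exists_list x) hle
  have hadj : ∀ {k1 c w d k2}, K = k1 ++ c :: w :: d :: k2 →
      IsPathList R.T ((u :: A.reverse ++ k1) ++ c :: w :: d :: (k2 ++ B ++ [v])) := by
    rintro k1 c w d k2 rfl
    simpa using hQ
  -- Because of the `+ 1` in `spreadPath`, a module path always contains both `A[0]` and `B[0]`,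
  -- hence is never trivial.
  have hzM : ∀ x z, R'.EndsOnTrivial x z → z ∉ M := by
    rintro x z ⟨w, hz, -⟩ hzM
    change R.V at w
    have hz : R.spreadPath M A K B a b z = {w} := hz
    rw [hpM z hzM] at hz
    have hAz : 0 < A.length := (Nat.zero_le _).trans_lt (ha z hzM)
    have hBz : 0 < B.length := (Nat.zero_le _).trans_lt (hb z hzM)
    have h1 : A[0] ∈ ({w} : Set R.V) := by
      rw [← hz]
      have := (getElem_mem_take_iff hnA (n := a z + 1) hAz).2 (by omega)
      simp [this]
    have h2 : B[0] ∈ ({w} : Set R.V) := by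
      rw [← hz]
      have := (getElem_mem_take_iff hnB (n := b z + 1) hBz).2 (by omega)
      simp [this]
    rw [Set.mem_singleton_iff] at h1 h2
    exact hAB _ (List.getElem_mem hAz) (by rw [h1, ← h2]; exact List.getElem_mem hBz)
  have hLz : ∀ z ∈ lowerOf M, ∀ w : R.V, R'.path z = {w} →
      R.path z = {w} ∧ ∃ k1 c d k2, K = k1 ++ c :: w :: d :: k2 := by
    intro z hz w h
    refine hL3 z hz w fun w' => ?_
    have h : R.spreadPath M A K B a b z = {w} := h
    rw [hpL z hz] at h
    simpa using Set.ext_iff.1 h w'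
  have hMz : ∀ m ∈ M, ∀ z, ¬ R'.EndsOnTrivial m z := by
    intro m hm z hmz
    have hz := hzM m z hmz
    have hzL : z ∈ lowerOf M := by
      have hlt : z < m := lt_of_le_of_ne hmz.le (by rintro rfl; exact hz hm)
      rcases hM z hz with h | h | h
      · exact h
      · exact absurd (h.2 m hm) hlt.le.not_gt
      · exact absurd hlt (h m hm).2
    obtain ⟨w, hw, hmw⟩ := hmz
    change R.V at w
    obtain ⟨-, k1, c, d, k2, hK⟩ := hLz z hzL w hw
    have hp := hadj hK
    have h3 := hp.infix (l' := [c, w, d]) ⟨u :: A.reverse ++ k1, k2 ++ B ++ [v], by simp⟩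
    have hKm : ∀ e ∈ K, e ∈ R.spreadPath M A K B a b m := fun e he => by
      rw [hpM m hm]; simp [he]
    have hcd := (R'.endsAt_iff.1 hmw).2 c (hKm c (by simp [hK])) d (hKm d (by simp [hK]))
      h3.1.rel.symm (by have := h3.1; simp at this; exact this.2)
    have := h3.2
    simp [hcd] at this
  refine ⟨R', hMz, fun x z hxz => ?_⟩
  · have hz := hzM x z hxz
    have hx : x ∉ M := fun hx => hMz x hx z hxz
    have hle' := hxz.le
    obtain ⟨w, hw, hxw⟩ := hxz
    change R.V at w
    have hzw : R.path z = {w} := by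
      by_cases hzL : z ∈ lowerOf M
      · exact (hLz z hzL w hw).1
      · have : R'.path z = R.path z := hpI z hz hzL
        exact this.symm.trans hw
    refine ⟨w, hzw, ?_⟩
    by_cases hxL : x ∈ lowerOf M
    · obtain ⟨-, k1, c, d, k2, hK⟩ := hLz z (hLM x hxL z hz hle') w hw
      have hp := hadj hK
      have hpath : R'.path x = _ := hpL x hxL
      obtain ⟨h1, h2⟩ := R'.endsAt_iff.1 hxw
      rw [hpath] at h1 h2
      -- Cutting a lower path down to `K` loses no neighbour of `w`, so it cannot turn `w` into an
      -- end.
      have hin : ∀ e ∈ R.path x, R.T.Adj w e → e ∈ K := by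
        intro e he hwe
        have := hp.eq_or_eq_of_adj hT (by have := hL x hxL e he; simpa [hK] using this) hwe
        rcases this with rfl | rfl <;> simp [hK]
      exact R.endsAt_iff.2 ⟨h1.2, fun e he e' he' hwe hwe' =>
        h2 e ⟨hin e he hwe, he⟩ e' ⟨hin e' he' hwe', he'⟩ hwe hwe'⟩
    · have : R'.path x = R.path x := hpI x hx hxL
      exact R.endsAt_iff.2 (this ▸ R'.endsAt_iff.1 hxw)

end Rep
-- Redrawing a module along a given path
namespace Rep

variable {X : Type*} [PartialOrder X]

/-- Subdividing both extreme edges of a path of the host tree. -/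
theorem exists_subdivide_ends (n : ℕ) (R : Rep X) {u v t s : R.V} {K l r : List R.V}
    (hQ : IsPathList R.T (u :: K ++ [v])) (ht : K ++ [v] = t :: l) (hs : u :: K = r ++ [s]) :
    ∃ (R' : Rep X) (h : R.V → R'.V) (P S : List R'.V), Function.Injective h ∧
      P.length = n + 1 ∧ S.length = n + 1 ∧
      IsPathList R'.T (h u :: (P ++ K.map h ++ S) ++ [h v]) ∧
      (∀ x w, h w ∈ R'.path x ↔ w ∈ R.path x) ∧
      (∀ x, ∀ p ∈ P, p ∈ R'.path x ↔ u ∈ R.path x ∧ t ∈ R.path x) ∧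
      (∀ x, ∀ p ∈ S, p ∈ R'.path x ↔ v ∈ R.path x ∧ s ∈ R.path x) ∧
      (∀ x, ∀ w ∈ R'.path x, (∃ w0, h w0 = w) ∨ w ∈ P ∨ w ∈ S) ∧
      (∀ w, h w ∉ P) ∧ (∀ w, h w ∉ S) ∧
      ∀ x z, R'.EndsOnTrivial x z → R.EndsOnTrivial x z := by
  obtain ⟨R1, f, P, hf, hPn, hPf, hl1, hp1, hE1⟩ :=
    R.exists_subdivide_list (n + 1) (u := u) (t := t) (l := l) (by rw [← ht]; simpa using hQ)
  have hf1 : ∀ x w, f w ∈ R1.path x ↔ w ∈ R.path x := by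
    intro x w
    rw [hp1]
    simp only [Set.mem_union, hf.mem_set_image, Set.mem_ofPred_eq, or_iff_left_iff_imp]
    rintro ⟨h, -⟩
    exact absurd ⟨w, rfl⟩ (hPf _ h)
  have hP1 : ∀ x, ∀ p ∈ P, p ∈ R1.path x ↔ u ∈ R.path x ∧ t ∈ R.path x := by
    intro x p hp
    rw [hp1]
    simp only [Set.mem_union, Set.mem_ofPred_eq, hp, true_and, or_iff_right_iff_imp]
    rintro ⟨w, -, rfl⟩
    exact absurd ⟨w, rfl⟩ (hPf _ hp)
  have key : ∃ t1 l1, (K.map f).reverse ++ P.reverse ++ [f u] = t1 :: l1 ∧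
      ∀ x, (f v ∈ R1.path x ∧ t1 ∈ R1.path x ↔ v ∈ R.path x ∧ s ∈ R.path x) := by
    -- If `K` is empty, both extreme edges are the single edge `uv`, already subdivided, so the
    -- vertex next to `v` is now the last one of `P`.
    rcases List.eq_nil_or_concat' K with rfl | ⟨K, s', rfl⟩
    · obtain rfl : u = s := by
        have : [u].getLast? = (r ++ [s]).getLast? := by rw [hs]
        simpa using this
      obtain rfl : v = t := by simp at ht; exact ht.1
      rcases hP : P.reverse with _ | ⟨p, P'⟩
      · simp at hP; simp [hP] at hPn
      · refine ⟨p, P' ++ [f u], by simp, fun x => ?_⟩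
        have : p ∈ P := by rw [← List.mem_reverse, hP]; simp
        rw [hf1, hP1 x p this]
        tauto
    · obtain rfl : s' = s := by
        have : (u :: (K ++ [s'])).getLast? = (r ++ [s]).getLast? := by rw [hs]
        simpa [List.getLast?_cons] using this
      exact ⟨f s', (K.map f).reverse ++ P.reverse ++ [f u], by simp, fun x => by rw [hf1, hf1]⟩
  obtain ⟨t1, l1, ht1, hx⟩ := key
  have hl1' : IsPathList R1.T (f v :: t1 :: l1) := by
    rw [← ht1]
    have e : f v :: ((K.map f).reverse ++ P.reverse ++ [f u]) =
        (f u :: P ++ (t :: l).map f).reverse := by rw [← ht]; simp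
    rw [e]
    exact hl1.reverse
  obtain ⟨R2, g, S, hg, hSn, hSg, hl2, hp2, hE2⟩ := R1.exists_subdivide_list (n + 1) hl1'
  have hg2 : ∀ x w, g w ∈ R2.path x ↔ w ∈ R1.path x := by
    intro x w
    rw [hp2]
    simp only [Set.mem_union, hg.mem_set_image, Set.mem_ofPred_eq, or_iff_left_iff_imp]
    rintro ⟨h, -⟩
    exact absurd ⟨w, rfl⟩ (hSg _ h)
  refine ⟨R2, g ∘ f, P.map g, S.reverse, hg.comp hf, by simp [hPn], by simp [hSn], ?_,
    fun x w => by rw [Function.comp, hg2, hf1], ?_, ?_, ?_, ?_, ?_,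
    fun x z h => hE1 x z (hE2 x z h)⟩
  · rw [← ht1] at hl2
    simpa [Function.comp_def] using hl2.reverse
  · intro x p hp
    obtain ⟨p, hp', rfl⟩ := List.mem_map.1 hp
    rw [hg2, hP1 x p hp']
  · intro x p hp
    rw [List.mem_reverse] at hp
    rw [← hx, hp2]
    simp only [Set.mem_union, Set.mem_ofPred_eq, hp, true_and, or_iff_right_iff_imp]
    rintro ⟨w, -, rfl⟩
    exact absurd ⟨w, rfl⟩ (hSg _ hp)
  · intro x w hw
    rw [hp2] at hw
    rcases hw with ⟨w, hw, rfl⟩ | ⟨hw, -⟩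
    · rw [hp1] at hw
      rcases hw with ⟨w, hw, rfl⟩ | ⟨hw, -⟩
      · exact Or.inl ⟨w, rfl⟩
      · exact Or.inr (Or.inl (List.mem_map_of_mem hw))
    · exact Or.inr (Or.inr (List.mem_reverse.2 hw))
  · intro w hw
    obtain ⟨p, hp, hpw⟩ := List.mem_map.1 hw
    exact hPf p hp ⟨w, (hg hpw).symm⟩
  · intro w hw
    exact hSg _ (List.mem_reverse.1 hw) ⟨f w, rfl⟩

/-- A module of dimension at most two can be represented along a path `Q` of the host tree
which is contained in the paths above it, contains the paths below it, and neither contains nor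
contains in its interior any incomparable path. -/
theorem exists_avoiding_of_path [Finite X] (R : Rep X) {M : Set X} (hM : IsOrderModule M) {a b : X → ℕ}
    (hab : ∀ x ∈ M, ∀ y ∈ M, x ≤ y ↔ a x ≤ a y ∧ b x ≤ b y) {u v : R.V} {K : List R.V}
    (hQ : IsPathList R.T (u :: K ++ [v]))
    (hU : ∀ x ∈ upperOf M, ∀ w ∈ u :: K ++ [v], w ∈ R.path x)
    (hL : ∀ x ∈ lowerOf M, ∀ w ∈ R.path x, w ∈ u :: K ++ [v])
    (hLu : ∀ x ∈ lowerOf M, R.path x ≠ {u}) (hLv : ∀ x ∈ lowerOf M, R.path x ≠ {v})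
    (hI : ∀ x, x ∉ M → x ∉ lowerOf M → x ∉ upperOf M →
      (¬ ∀ w ∈ u :: K ++ [v], w ∈ R.path x) ∧ ¬ ∀ w ∈ R.path x, w ∈ K) :
    ∃ R' : Rep X, (∀ m ∈ M, ∀ z, ¬ R'.EndsOnTrivial m z) ∧
      ∀ x z, R'.EndsOnTrivial x z → R.EndsOnTrivial x z := by
  obtain ⟨N, hN⟩ : ∃ N, ∀ x, a x < N ∧ b x < N := by
    obtain ⟨N1, h1⟩ := (Set.finite_range a).bddAbove
    obtain ⟨N2, h2⟩ := (Set.finite_range b).bddAbove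
    refine ⟨max N1 N2 + 1, fun x => ?_⟩
    have := h1 ⟨x, rfl⟩
    have := h2 ⟨x, rfl⟩
    omega
  obtain ⟨t, l, ht⟩ : ∃ t l, K ++ [v] = t :: l := by cases K <;> simp
  obtain ⟨r, s, hs⟩ : ∃ r s, u :: K = r ++ [s] := by
    rcases List.eq_nil_or_concat' (u :: K) with h | ⟨r, s, h⟩
    · simp at h
    · exact ⟨r, s, h⟩
  obtain ⟨R', h, P, S, hh, hP, hS, hl, hhw, hPw, hSw, hw, hhP, hhS, hE⟩ :=
    R.exists_subdivide_ends N hQ ht hs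
  -- Of the `N + 1` new vertices on each side, the innermost (`p`, resp. `q`) joins the core; the
  -- other `N` receive the ends of the module paths.
  obtain ⟨P1, p, rfl⟩ : ∃ P1 p, P = P1 ++ [p] := by
    rcases List.eq_nil_or_concat' P with h | h
    · simp [h] at hP
    · exact h
  obtain ⟨q, B, rfl⟩ : ∃ q B, S = q :: B := by
    rcases S with _ | ⟨q, B⟩
    · simp at hS
    · exact ⟨q, B, rfl⟩
  have hn := hl.2
  have htQ : t ∈ K ∨ t = v := by
    have : t ∈ K ++ [v] := by rw [ht]; simp
    simpa using this
  have hsQ : s ∈ K ∨ s = u := by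
    have : s ∈ u :: K := by rw [hs]; simp
    simp at this; tauto
  -- A lower path through `u` is not `{u}` and stays in `Q`, so it uses the edge `ut` and hence
  -- contains `p`. Thus `p` records whether `u` is reached.
  have hu : ∀ x ∈ lowerOf M, u ∈ R.path x → t ∈ R.path x := by
    intro x hx hux
    obtain ⟨w, hw, hwu⟩ : ∃ w ∈ R.path x, w ≠ u := by
      by_contra! h
      exact hLu x hx (Set.eq_singleton_iff_unique_mem.2 ⟨hux, h⟩)
    have hwQ : w ∈ t :: l := by
      have := hL x hx w hw
      rw [← ht]
      simpa [hwu] using this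
    rcases List.mem_cons.1 hwQ with rfl | hwl
    · exact hw
    · obtain ⟨l1, l2, rfl⟩ := List.append_of_mem hwl
      have hk : IsPathList R.T (u :: (t :: l1) ++ [w]) :=
        hQ.infix ⟨[], l2, by
          have := congrArg (List.cons u) ht; simpa using this.symm⟩
      exact R.convex hux hw hk t (by simp)
  have hv : ∀ x ∈ lowerOf M, v ∈ R.path x → s ∈ R.path x := by
    intro x hx hvx
    obtain ⟨w, hw, hwu⟩ : ∃ w ∈ R.path x, w ≠ v := by
      by_contra! h
      exact hLv x hx (Set.eq_singleton_iff_unique_mem.2 ⟨hvx, h⟩)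
    have hwQ : w ∈ r ++ [s] := by
      have := hL x hx w hw
      rw [← hs]
      simpa [hwu] using this
    rcases List.mem_append.1 hwQ with hwl | hws
    · obtain ⟨l1, l2, rfl⟩ := List.append_of_mem hwl
      have hk : IsPathList R.T (w :: (l2 ++ [s]) ++ [v]) :=
        hQ.infix ⟨l1, [], by rw [hs]; simp⟩
      exact R.convex hw hvx hk s (by simp)
    · rwa [List.mem_singleton.1 hws] at hw
  have hpq : p ≠ q := by simp [List.nodup_append] at hn; grind
  have hpw : ∀ x, p ∈ R'.path x ↔ u ∈ R.path x ∧ t ∈ R.path x := fun x => hPw x p (by simp)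
  have hqw : ∀ x, q ∈ R'.path x ↔ v ∈ R.path x ∧ s ∈ R.path x := fun x => hSw x q (by simp)
  have hmem : ∀ x ∈ lowerOf M, ∀ w ∈ R'.path x,
      (∃ k ∈ K, h k = w) ∨ (u ∈ R.path x ∧ (w = h u ∨ w ∈ P1 ++ [p])) ∨
        (v ∈ R.path x ∧ (w = h v ∨ w ∈ q :: B)) := by
    intro x hx w hw'
    rcases hw x w hw' with ⟨w, rfl⟩ | h' | h'
    · rw [hhw] at hw'
      have := hL x hx w hw'
      simp only [List.mem_cons, List.mem_append, List.not_mem_nil, or_false] at this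
      rcases this with (rfl | h) | rfl
      · exact Or.inr (Or.inl ⟨hw', Or.inl rfl⟩)
      · exact Or.inl ⟨w, h, rfl⟩
      · exact Or.inr (Or.inr ⟨hw', Or.inl rfl⟩)
    · exact Or.inr (Or.inl ⟨((hPw x w h').1 hw').1, Or.inr h'⟩)
    · exact Or.inr (Or.inr ⟨((hSw x w h').1 hw').1, Or.inr h'⟩)
  have hup : ∀ x, p ∈ R'.path x → ∀ w, w = h u ∨ w ∈ P1 ++ [p] → w ∈ R'.path x := by
    rintro x hx w (rfl | h)
    · exact (hhw x u).2 ((hpw x).1 hx).1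
    · exact (hPw x w h).2 ((hpw x).1 hx)
  have hvq : ∀ x, q ∈ R'.path x → ∀ w, w = h v ∨ w ∈ q :: B → w ∈ R'.path x := by
    rintro x hx w (rfl | h)
    · exact (hhw x v).2 ((hqw x).1 hx).1
    · exact (hSw x w h).2 ((hqw x).1 hx)
  have hKmem : ∀ w, w ∈ p :: K.map h ++ [q] ↔ w = p ∨ (∃ k ∈ K, h k = w) ∨ w = q := by
    intro w; simp
  have hsplit : h u :: (P1.reverse.reverse ++ (p :: K.map h ++ [q]) ++ B) ++ [h v] =
      h u :: (P1 ++ [p] ++ K.map h ++ q :: B) ++ [h v] := by simp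
  have huv : h u ∉ P1 ++ [p] ++ K.map h ++ q :: B := by
    intro h'
    have := (List.nodup_cons.1 (show (h u :: ((P1 ++ [p] ++ K.map h ++ q :: B) ++ [h v])).Nodup
      from hn)).1
    exact this (List.mem_append_left _ h')
  obtain ⟨R'', hR1, hR2⟩ := R'.exists_spread (A := P1.reverse) (K := p :: K.map h ++ [q]) (B := B)
    (u := h u) (v := h v) hM hab
    (fun x _ => by simp at hP ⊢; have := hN x; omega)
    (fun x _ => by simp at hS; have := hN x; omega)
    (by rw [hsplit]; exact hl)
    (by
      rw [hsplit]
      intro x hx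
      have hQx := hU x hx
      have hux := hQx u (by simp)
      have hvx := hQx v (by simp)
      have htx : t ∈ R.path x := hQx t (by simp; tauto)
      have hsx : s ∈ R.path x := hQx s (by simp; tauto)
      intro w hw
      simp only [List.mem_cons, List.mem_append, List.not_mem_nil, or_false, List.mem_map] at hw
      rcases hw with (rfl | (h' | ⟨k, hk, rfl⟩) | h') | rfl
      · exact (hhw x u).2 hux
      · exact (hPw x w (by simpa using h')).2 ⟨hux, htx⟩
      · exact (hhw x k).2 (hQx k (by simp [hk]))
      · exact (hSw x w (by simpa using h')).2 ⟨hvx, hsx⟩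
      · exact (hhw x v).2 hvx)
    (by
      rw [hsplit]
      intro x hx w hw'
      rcases hmem x hx w hw' with ⟨k, hk, rfl⟩ | ⟨-, rfl | h'⟩ | ⟨-, rfl | h'⟩
      · simp only [List.mem_cons, List.mem_append, List.mem_map]
        exact Or.inl (Or.inr (Or.inl (Or.inr ⟨k, hk, rfl⟩)))
      · simp
      · simp at h' ⊢; tauto
      · simp
      · simp at h' ⊢; tauto)
    (by
      intro x hx
      obtain ⟨w, hw'⟩ := R'.path_nonempty x
      rcases hmem x hx w hw' with ⟨k, hk, rfl⟩ | ⟨hux, -⟩ | ⟨hvx, -⟩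
      · exact ⟨h k, by simp only [hKmem]; exact Or.inr (Or.inl ⟨k, hk, rfl⟩), hw'⟩
      · exact ⟨p, by simp, (hpw x).2 ⟨hux, hu x hx hux⟩⟩
      · exact ⟨q, by simp, (hqw x).2 ⟨hvx, hv x hx hvx⟩⟩)
    (by
      intro x hx y _ hxy w hw'
      rcases hmem x hx w hw' with ⟨k, hk, rfl⟩ | ⟨hux, h'⟩ | ⟨hvx, h'⟩
      · exact hxy _ (by simp only [hKmem]; exact Or.inr (Or.inl ⟨k, hk, rfl⟩)) hw'
      · exact hup y (hxy p (by simp) ((hpw x).2 ⟨hux, hu x hx hux⟩)) w h'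
      · exact hvq y (hxy q (by simp) ((hqw x).2 ⟨hvx, hv x hx hvx⟩)) w h')
    (by
      intro x hx w hw'
      -- Otherwise the one-vertex trace would contain `p` and also `h t`, or `q` when `t = v`.
      have hux : u ∉ R.path x := by
        intro hux
        have htx := hu x hx hux
        have h1 := (hw' p).1 ⟨by simp, (hpw x).2 ⟨hux, htx⟩⟩
        rcases htQ with h2 | rfl
        · have h3 := (hw' (h t)).1 ⟨by simp only [hKmem]; exact Or.inr (Or.inl ⟨t, h2, rfl⟩),
            (hhw x t).2 htx⟩
          exact hhP t (by rw [h3, ← h1]; simp)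
        · have h3 := (hw' q).1 ⟨by simp, (hqw x).2 ⟨htx, hv x hx htx⟩⟩
          exact hpq (h1.trans h3.symm)
      have hvx : v ∉ R.path x := by
        intro hvx
        have hsx := hv x hx hvx
        have h1 := (hw' q).1 ⟨by simp, (hqw x).2 ⟨hvx, hsx⟩⟩
        rcases hsQ with h2 | rfl
        · have h3 := (hw' (h s)).1 ⟨by simp only [hKmem]; exact Or.inr (Or.inl ⟨s, h2, rfl⟩),
            (hhw x s).2 hsx⟩
          exact hhS s (by rw [h3, ← h1]; simp)
        · exact hux hsx
      obtain ⟨hwK, hwx⟩ := (hw' w).2 rfl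
      obtain ⟨k, hk, rfl⟩ : ∃ k ∈ K, h k = w := by
        rcases hmem x hx w hwx with h' | ⟨h', -⟩ | ⟨h', -⟩
        · exact h'
        · exact absurd h' hux
        · exact absurd h' hvx
      refine ⟨Set.eq_singleton_iff_unique_mem.2 ⟨hwx, fun w hw'' => ?_⟩, ?_⟩
      · rcases hmem x hx w hw'' with ⟨k', hk', rfl⟩ | ⟨h', -⟩ | ⟨h', -⟩
        · exact (hw' _).1 ⟨by simp only [hKmem]; exact Or.inr (Or.inl ⟨k', hk', rfl⟩), hw''⟩
        · exact absurd h' hux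
        · exact absurd h' hvx
      · obtain ⟨k1, k2, rfl⟩ := List.append_of_mem hk
        -- Having `p` and `q` in the core gives every vertex coming from `K` a neighbour on each
        -- side.
        obtain ⟨j1, c, hc⟩ : ∃ j1 c, p :: k1.map h = j1 ++ [c] := by
          rcases List.eq_nil_or_concat' (p :: k1.map h) with h | h
          · simp at h
          · exact h
        obtain ⟨d, j2, hd⟩ : ∃ d j2, k2.map h ++ [q] = d :: j2 := by cases k2 <;> simp
        refine ⟨j1, c, d, j2, ?_⟩
        have : p :: (k1 ++ k :: k2).map h ++ [q] = (p :: k1.map h) ++ h k :: (k2.map h ++ [q]) := by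
          simp
        rw [this, hc, hd]
        simp)
    (by
      intro x hx hxL hall
      have e : P1.reverse.reverse ++ (p :: K.map h ++ [q]) ++ B =
        P1 ++ [p] ++ K.map h ++ q :: B := by simp
      rw [e] at hall
      by_cases hxU : x ∈ upperOf M
      · exact huv (hall _ ((hhw x u).2 (hU x hxU u (by simp))))
      · refine (hI x hx hxL hxU).2 fun w hw' => ?_
        have := hall _ ((hhw x w).2 hw')
        rw [List.mem_append, List.mem_append, List.mem_map] at this
        rcases this with (h' | ⟨k, hk, h'⟩) | h'
        · exact absurd h' (hhP w)
        · exact hh h' ▸ hk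
        · exact absurd h' (hhS w))
    (by
      intro x hx hxL hxU hall
      refine (hI x hx hxL hxU).1 fun w hw' => ?_
      simp only [List.mem_cons, List.mem_append, List.not_mem_nil, or_false] at hw'
      rcases hw' with (rfl | hk) | rfl
      · exact ((hpw x).1 (hall p (by simp))).1
      · exact (hhw x w).1 (hall _ (by simp only [hKmem]; exact Or.inr (Or.inl ⟨w, hk, rfl⟩)))
      · exact ((hqw x).1 (hall q (by simp))).1)
  exact ⟨R'', hR1, fun x z h => hE x z (hR2 x z h)⟩

end Rep
/-! ### Strong modules and dimension -/

section Order

variable {X : Type*} [PartialOrder X]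

theorem compGraph_adj {x y : X} : (compGraph X).Adj x y ↔ x < y ∨ y < x := Iff.rfl

/-- An element outside a strong module never splits it into a lower and an upper part. -/
theorem IsStrongModule.isOrderModule {M : Set X} (hM : IsStrongModule M) : IsOrderModule M := by
  intro z hz
  rcases hM.1 z hz with hzc | hzi
  swap
  · exact Or.inr (Or.inr fun m hm => ⟨fun h => hzi m hm (Or.inr h), fun h => hzi m hm (Or.inl h)⟩)
  by_contra hcon
  push Not at hcon
  obtain ⟨hnl, hnu, -⟩ := hcon
  obtain ⟨d, hd, hdz⟩ : ∃ d ∈ M, d < z := by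
    by_contra! h
    exact hnl ⟨hz, fun m hm => (hzc m hm).resolve_right (h m hm)⟩
  obtain ⟨e, he, hze⟩ : ∃ e ∈ M, z < e := by
    by_contra! h
    exact hnu ⟨hz, fun m hm => (hzc m hm).resolve_left (h m hm)⟩
  -- The elements of `M` above `z`, together with the outside elements separating `M` the way `z`
  -- does. This is a module containing `z` and `e` but not `d`, so it overlaps `M`.
  let N : Set X := {w | (w ∈ M ∧ z < w) ∨
    (w ∉ M ∧ ∀ m ∈ M, (m < z → m < w) ∧ (z < m → w < m))}
  have hzN : z ∈ N := Or.inr ⟨hz, fun m _ => ⟨id, id⟩⟩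
  have hN : IsModule N := by
    intro y hy
    by_cases hyM : y ∈ M
    · have hyz : y < z := (hzc y hyM).resolve_left fun h => hy (Or.inl ⟨hyM, h⟩)
      left
      rintro w (⟨-, hw⟩ | ⟨-, hw⟩)
      · exact Or.inl (hyz.trans hw)
      · exact Or.inl ((hw y hyM).1 hyz)
    rcases hM.1 y hyM with hyc | hyi
    · left
      -- If `y` were incomparable to some `w` in `N`, transitivity would force `y` to separate `M`
      -- just as `w` does, putting `y` in `N`.
      by_contra! hcon
      obtain ⟨w, hw, hyw⟩ := hcon
      have hwM : w ∉ M := fun h => hyw (hyc w h)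
      rw [compGraph_adj, not_or] at hyw
      rcases hw with ⟨h, -⟩ | ⟨-, hw⟩
      · exact hwM h
      refine hy (Or.inr ⟨hyM, fun m hm => ⟨fun hmz => ?_, fun hmz => ?_⟩⟩)
      · exact (hyc m hm).resolve_left fun h => hyw.1 (h.trans ((hw m hm).1 hmz))
      · exact (hyc m hm).resolve_right fun h => hyw.2 (((hw m hm).2 hmz).trans h)
    · right
      rintro w (⟨hwM, -⟩ | ⟨-, hw⟩)
      · exact hyi w hwM
      · rintro (h | h)
        · exact hyi e he (Or.inl (h.trans ((hw e he).2 hze)))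
        · exact hyi d hd (Or.inr (((hw d hd).1 hdz).trans h))
  rcases hM.2 N hN with h | h | h
  · have : e ∈ M ∩ N := ⟨he, Or.inl ⟨he, hze⟩⟩
    simp [h] at this
  · rcases h hd with ⟨-, h'⟩ | ⟨h', -⟩
    · exact h'.not_gt hdz
    · exact h' hd
  · exact hz (h hzN)

/-- In a chain the complement of the comparability graph has no edges. -/
theorem isCliqueModule_of_comparable {M : Set X} (hM : M.Nontrivial)
    (h : ∀ x ∈ M, ∀ y ∈ M, x ≤ y ∨ y ≤ x) : IsCliqueModule M := by
  intro hc
  obtain ⟨x, hx, y, hy, hxy⟩ := hM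
  obtain ⟨p⟩ := hc.preconnected ⟨x, hx⟩ ⟨y, hy⟩
  cases p with
  | nil => exact hxy rfl
  | @cons _ w _ hadj _ =>
    rw [SimpleGraph.compl_adj] at hadj
    have hne : x ≠ w := fun h => hadj.1 (Subtype.ext h)
    rcases h x hx w w.2 with h | h
    · exact hadj.2 (Or.inl (lt_of_le_of_ne h hne))
    · exact hadj.2 (Or.inr (lt_of_le_of_ne h hne.symm))

namespace Rep

/-- The elements below `y` are represented by intervals of the path of `y`. -/
theorem exists_interval (R : Rep X) (y : X) :
    ∃ (l : List R.V) (i j : X → ℕ), R.path y = {w | w ∈ l} ∧ l.Nodup ∧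
      (∀ k (hk : k + 1 < l.length), R.T.Adj l[k] l[k + 1]) ∧
      ∀ x ≤ y, i x < j x ∧ j x ≤ l.length ∧
        ∀ k (hk : k < l.length), l[k] ∈ R.path x ↔ i x ≤ k ∧ k < j x := by
  obtain ⟨l, -, hl, hy⟩ := R.exists_list y
  have key : ∀ x, ∃ i j, x ≤ y → i < j ∧ j ≤ l.length ∧
      ∀ k (hk : k < l.length), l[k] ∈ R.path x ↔ i ≤ k ∧ k < j := by
    intro x
    by_cases hxy : x ≤ y
    swap
    · exact ⟨0, 0, fun h => absurd h hxy⟩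
    obtain ⟨l', -, hl', hx⟩ := R.exists_list x
    obtain ⟨w, hw⟩ := R.path_nonempty x
    have hwy := (R.le_iff x y).1 hxy hw
    rw [hx] at hw
    rw [hy] at hwy
    obtain ⟨k, h0, ⟨p, s, hps⟩, hk⟩ := exists_isPathList_inter R.isTree.isAcyclic hl hl' ⟨w, hwy, hw⟩
    have hk' : ∀ w ∈ l, w ∈ R.path x ↔ w ∈ k := fun w hw => by
      rw [hx, hk]; simp [hw]
    have h0' := List.length_pos_iff.2 h0
    refine ⟨p.length, p.length + k.length, fun _ => ⟨by omega, by simp [← hps], ?_⟩⟩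
    intro r hr
    rw [hk' _ (List.getElem_mem hr)]
    have hn := hl.2
    subst hps
    rw [List.nodup_append, List.nodup_append] at hn
    obtain ⟨⟨-, -, hpk⟩, -, hks⟩ := hn
    have hr' := hr
    simp only [List.length_append] at hr'
    rcases lt_or_ge r p.length with h1 | h1
    · have : (p ++ k ++ s)[r] ∈ p := by
        rw [List.getElem_append_left (by simp; omega), List.getElem_append_left h1]
        exact List.getElem_mem _
      exact iff_of_false (fun h => hpk _ this _ h rfl) (by omega)
    · rcases lt_or_ge r (p.length + k.length) with h2 | h2
      · have : (p ++ k ++ s)[r] ∈ k := by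
          rw [List.getElem_append_left (by simpa using h2), List.getElem_append_right h1]
          exact List.getElem_mem _
        exact iff_of_true this ⟨h1, h2⟩
      · have : (p ++ k ++ s)[r] ∈ s := by
          rw [List.getElem_append_right (by simpa using h2)]
          exact List.getElem_mem _
        exact iff_of_false (fun h => hks _ (List.mem_append_right _ h) _ this rfl) (by omega)
  choose i j hij using key
  refine ⟨l, i, j, hy, hl.2, fun k hk => ?_, hij⟩
  exact List.isChain_iff_getElem.1 hl.1 k hk

theorem le_iff_of_interval {R : Rep X} {y : X} {l : List R.V} {i j : X → ℕ}
    (hy : R.path y = {w | w ∈ l})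
    (h : ∀ x ≤ y, i x < j x ∧ j x ≤ l.length ∧
        ∀ k (hk : k < l.length), l[k] ∈ R.path x ↔ i x ≤ k ∧ k < j x) {x z : X}
    (hx : x ≤ y) (hz : z ≤ y) : x ≤ z ↔ i z ≤ i x ∧ j x ≤ j z := by
  obtain ⟨h1, h2, h3⟩ := h x hx
  obtain ⟨h1', h2', h3'⟩ := h z hz
  rw [R.le_iff]
  constructor
  · intro hs
    have a1 := (h3' (i x) (by omega)).1 (hs ((h3 (i x) (by omega)).2 ⟨le_rfl, h1⟩))
    have a2 := (h3' (j x - 1) (by omega)).1 (hs ((h3 (j x - 1) (by omega)).2 (by omega)))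
    omega
  · intro hs w hw
    have : w ∈ l := by
      have := (R.le_iff x y).1 hx hw
      rwa [hy] at this
    obtain ⟨k, hk, rfl⟩ := List.getElem_of_mem this
    have := (h3 k hk).1 hw
    exact (h3' k hk).2 (by omega)

/-- Inclusion of intervals in the path of `y` is a product order once left ends are measured from
the far end. The subtraction never truncates, as `i x < j x ≤ l.length`. -/
theorem exists_dim_two_of_le (R : Rep X) {M : Set X} {y : X} (hy : ∀ m ∈ M, m ≤ y) :
    ∃ a b : X → ℕ, ∀ x ∈ M, ∀ z ∈ M, x ≤ z ↔ a x ≤ a z ∧ b x ≤ b z := by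
  obtain ⟨l, i, j, hl, -, -, h⟩ := R.exists_interval y
  refine ⟨fun x => l.length - i x, j, fun x hx z hz => ?_⟩
  rw [le_iff_of_interval hl h (hy x hx) (hy z hz)]
  have h1 := h x (hy x hx)
  have h2 := h z (hy z hz)
  dsimp only
  omega

/-- The dual representation serves only here: a module with a lower element also has two
coordinates, those of the dual subtracted from upper bounds. -/
theorem exists_dim_two_of_ge [Finite X] (R : Rep Xᵒᵈ) {M : Set X} {y : X}
    (hy : ∀ m ∈ M, y ≤ m) :
    ∃ a b : X → ℕ, ∀ x ∈ M, ∀ z ∈ M, x ≤ z ↔ a x ≤ a z ∧ b x ≤ b z := by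
  obtain ⟨a, b, h⟩ := R.exists_dim_two_of_le (M := OrderDual.ofDual ⁻¹' M)
    (y := OrderDual.toDual y) (fun m hm => hy _ hm)
  obtain ⟨N1, h1⟩ := (Set.finite_range a).bddAbove
  obtain ⟨N2, h2⟩ := (Set.finite_range b).bddAbove
  refine ⟨fun x => N1 - a (OrderDual.toDual x), fun x => N2 - b (OrderDual.toDual x),
    fun x hx z hz => ?_⟩
  rw [← OrderDual.toDual_le_toDual, h (OrderDual.toDual z) hz (OrderDual.toDual x) hx]
  have a1 := h1 ⟨OrderDual.toDual x, rfl⟩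
  have a2 := h1 ⟨OrderDual.toDual z, rfl⟩
  have a3 := h2 ⟨OrderDual.toDual x, rfl⟩
  have a4 := h2 ⟨OrderDual.toDual z, rfl⟩
  dsimp only
  omega

end Rep

end Order

/-! ### Finding a path for the module, or a blocking vertex -/

namespace Rep

variable {X : Type*} [PartialOrder X]

theorem subset_of_mem_ends {R : Rep X} {x y : X} {u v : R.V} {K : List R.V}
    (hl : IsPathList R.T (u :: K ++ [v])) (hx : R.path x = {w | w ∈ u :: K ++ [v]})
    (hu : u ∈ R.path y) (hv : v ∈ R.path y) : x ≤ y := by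
  rw [R.le_iff, hx]
  exact R.convex hu hv hl

theorem exists_list_two_le (R : Rep X) {x : X} (hx : ∀ a, R.path x ≠ {a}) :
    ∃ u K v, IsPathList R.T (u :: K ++ [v]) ∧ R.path x = {w | w ∈ u :: K ++ [v]} := by
  obtain ⟨l, h0, hl, h⟩ := R.exists_list x
  rcases l with _ | ⟨u, l⟩
  · exact absurd rfl h0
  rcases List.eq_nil_or_concat' l with rfl | ⟨K, v, rfl⟩
  · exact absurd (by rw [h]; ext; simp) (hx u)
  · exact ⟨u, K, v, hl, h⟩

/-- A module all of whose paths leave `u` through one side, while the paths above the module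
leave through another neighbour `b`, can be moved away from the trivial paths. -/
theorem exists_avoiding_of_adj [Finite X] (R : Rep X) {M : Set X}
    (hM : IsOrderModule M) {i j : X → ℕ}
    (hij : ∀ x ∈ M, ∀ y ∈ M, x ≤ y ↔ i x ≤ i y ∧ j x ≤ j y) {m : X} (hm : m ∈ M)
    {u v b : R.V} {K : List R.V} (hl : IsPathList R.T (u :: K ++ [v]))
    (hpath : R.path m = {w | w ∈ u :: K ++ [v]}) (hv : ∀ z ∈ lowerOf M, R.path z ≠ {v})
    (hub : R.T.Adj u b) (hb : b ∉ R.path m) (hbU : ∀ x ∈ upperOf M, b ∈ R.path x) :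
    ∃ R' : Rep X, (∀ m ∈ M, ∀ z, ¬ R'.EndsOnTrivial m z) ∧
      ∀ x z, R'.EndsOnTrivial x z → R.EndsOnTrivial x z := by
  have hmem : ∀ w, w ∈ R.path m ↔ w ∈ u :: K ++ [v] := fun w => by rw [hpath]; rfl
  have hL : ∀ x ∈ lowerOf M, R.path x ⊆ R.path m := fun x hx => (R.le_iff x m).1 (hx.2 m hm).le
  -- Prolonging by `b` makes `u` interior to the strip, so a trivial path at `u` does no harm; no
  -- lower path contains `b`.
  refine R.exists_avoiding_of_path (u := b) (K := u :: K) (v := v) hM hij ⟨?_, ?_⟩ ?_ ?_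
    ?_ hv ?_
  · exact List.isChain_cons_cons.2 ⟨hub.symm, hl.1⟩
  · exact List.nodup_cons.2 ⟨fun h => hb ((hmem b).2 h), hl.2⟩
  · intro x hx w hw
    rcases List.mem_cons.1 hw with rfl | hw
    · exact hbU x hx
    · exact (R.le_iff m x).1 (hx.2 m hm).le ((hmem w).2 hw)
  · intro x hx w hw
    exact List.mem_cons_of_mem _ ((hmem w).1 (hL x hx hw))
  · intro x hx h
    exact hb (hL x hx (h ▸ rfl))
  · intro x hx hxL hxU
    have hinc : ∀ m ∈ M, ¬ m < x ∧ ¬ x < m := ((hM x hx).resolve_left hxL).resolve_left hxU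
    have hne : x ≠ m := fun h => hx (h ▸ hm)
    constructor
    · intro h
      exact (hinc m hm).1 (lt_of_le_of_ne ((R.le_iff m x).2 fun w hw =>
        h w (List.mem_cons_of_mem _ ((hmem w).1 hw))) hne.symm)
    · intro h
      refine (hinc m hm).2 (lt_of_le_of_ne ((R.le_iff x m).2 fun w hw => (hmem w).2 ?_) hne)
      exact List.mem_append_left _ (h w hw)

/-- A module with a trivial path can be moved away from the trivial paths. -/
theorem exists_avoiding_of_trivial_mem [Finite X] (R : Rep X) {M : Set X} (hM : IsOrderModule M)
    (hnt : M.Nontrivial) {z y : X} (hz : z ∈ M) {a : R.V} (hza : R.path z = {a})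
    (hy : y ∈ upperOf M) :
    ∃ R' : Rep X, (∀ m ∈ M, ∀ z, ¬ R'.EndsOnTrivial m z) ∧
      ∀ x z, R'.EndsOnTrivial x z → R.EndsOnTrivial x z := by
  have hL : ∀ x, x ∉ lowerOf M := by
    intro x hx
    have h := (R.lt_iff x z).1 (hx.2 z hz)
    rw [hza, Set.ssubset_singleton_iff] at h
    exact (R.path_nonempty x).ne_empty h
  have ha : ∀ x, a ∈ R.path x ↔ z ≤ x := fun x => by
    rw [R.le_iff, hza, Set.singleton_subset_iff]
  obtain ⟨i, j, hij⟩ := R.exists_dim_two_of_le (M := M) (y := y) fun m hm => (hy.2 m hm).le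
  obtain ⟨m, hm, hmz⟩ := hnt.exists_ne z
  obtain ⟨t, ht, hta⟩ : ∃ t ∈ R.path m, t ≠ a := by
    by_contra! h
    obtain ⟨w, hw⟩ := R.path_nonempty m
    have hwa := h w hw
    subst hwa
    exact hmz (R.injective ((Set.eq_singleton_iff_unique_mem.2 ⟨hw, h⟩).trans hza.symm))
  have htU : ∀ x ∈ upperOf M, t ∈ R.path x := fun x hx =>
    (R.le_iff m x).1 (hx.2 m hm).le ht
  have haU : ∀ x ∈ upperOf M, a ∈ R.path x := fun x hx => (ha x).2 (hx.2 z hz).le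
  obtain ⟨k, hk⟩ : ∃ k, IsPathList R.T (a :: k ++ [t]) := by
    obtain ⟨l, -, hl, h⟩ := R.exists_list y
    have h1 := haU y hy
    have h2 := htU y hy
    rw [h] at h1 h2
    obtain ⟨k, hk | hk⟩ := exists_infix_of_mem h1 h2 hta.symm
    · exact ⟨k, hl.infix hk⟩
    · exact ⟨k, hl.reverse.infix hk⟩
  obtain ⟨c, r, hc⟩ : ∃ c r, k ++ [t] = c :: r := by cases k <;> simp
  have hcU : ∀ x ∈ upperOf M, c ∈ R.path x := fun x hx =>
    R.convex (haU x hx) (htU x hx) hk c (by rw [List.cons_append, hc]; simp)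
  -- The strip is the first edge `ac` from `a` towards `t`, common to all upper paths. There are no
  -- lower paths, and incomparable ones miss `a`.
  refine R.exists_avoiding_of_path (u := a) (K := []) (v := c) hM hij
    (hk.infix ⟨[], r, by
      have := congrArg (List.cons a) hc; simpa using this.symm⟩) ?_
    (fun x hx => absurd hx (hL x)) (fun x hx => absurd hx (hL x)) (fun x hx => absurd hx (hL x)) ?_
  · intro x hx w hw
    simp only [List.cons_append, List.nil_append, List.mem_cons, List.not_mem_nil, or_false] at hw
    rcases hw with rfl | rfl
    · exact haU x hx
    · exact hcU x hx
  · intro x hx hxL hxU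
    have hinc : ∀ m ∈ M, ¬ m < x ∧ ¬ x < m := ((hM x hx).resolve_left hxL).resolve_left hxU
    constructor
    · intro h
      exact (hinc z hz).1 (lt_of_le_of_ne ((ha x).1 (h a (by simp))) fun h => hx (h ▸ hz))
    · intro h
      obtain ⟨w, hw⟩ := R.path_nonempty x
      simpa using h w hw

/-- If the path of `m` ends at the trivial path of an element below `M`, and every neighbour of
that end outside the path of `m` is missed by some path above `M`, then `M` is a blocked clique
module. -/
theorem isBlocked_of_forall_adj (R : Rep X) {M : Set X} (hnt : M.Nontrivial)
    (htriv : ∀ x ∈ M, ∀ a, R.path x ≠ {a}) {m z y : X} (hm : m ∈ M) (hz : z ∈ lowerOf M)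
    (hy : y ∈ upperOf M) {u : R.V} (hzu : R.path z = {u}) (hmu : R.EndsAt m u)
    (hno : ∀ b, R.T.Adj u b → b ∉ R.path m → ¬ ∀ x ∈ upperOf M, b ∈ R.path x) :
    IsCliqueModule M ∧ R.IsBlocked M := by
  -- A neighbour of `u` on any path of `M` lies on all upper paths, so by `hno` it is already on the
  -- path of `m`.
  have hin : ∀ x ∈ M, ∀ b ∈ R.path x, R.T.Adj u b → b ∈ R.path m := by
    intro x hx b hb hub
    by_contra hbm
    exact hno b hub hbm fun w hw => (R.le_iff x w).1 (hw.2 x hx).le hb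
  have huM : ∀ x ∈ M, u ∈ R.path x := fun x hx =>
    (R.le_iff z x).1 (hz.2 x hx).le (hzu ▸ rfl)
  have hone := (R.endsAt_iff.1 hmu).2
  have hends : ∀ x ∈ M, R.EndsAt x u := fun x hx => R.endsAt_iff.2 ⟨huM x hx,
    fun b hb c hc hub huc => hone b (hin x hx b hb hub) c (hin x hx c hc huc) hub huc⟩
  refine ⟨?_, u, hends, ⟨z, hz.1, hzu⟩, ?_⟩
  swap
  · rintro ⟨b, hub, hbM, hb⟩
    exact hno b hub (hbM m hm) fun x hx =>
      hb x hx.1 fun m hm => (R.le_iff m x).1 (hx.2 m hm).le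
  have hnb : ∀ x ∈ M, ∃ c ∈ R.path x, R.T.Adj u c := by
    intro x hx
    obtain ⟨l, hl, h⟩ := isPathEndingAt_iff_list.1 (hends x hx)
    rcases l with _ | ⟨c, l⟩
    · exact absurd (by rw [h]; ext; simp) (htriv x hx u)
    · exact ⟨c, by rw [h]; simp, hl.1.rel⟩
  obtain ⟨c, hcm, huc⟩ := hnb m hm
  have hcM : ∀ x ∈ M, c ∈ R.path x := by
    intro x hx
    obtain ⟨d, hd, hud⟩ := hnb x hx
    rwa [hone c hcm d (hin x hx d hd hud) huc hud]
  obtain ⟨l, i, j, hl, hnd, hadj, hint⟩ := R.exists_interval y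
  have hyM : ∀ x ∈ M, x ≤ y := fun x hx => (hy.2 x hx).le
  have hul : u ∈ l := by
    have := (R.le_iff m y).1 (hyM m hm) (huM m hm)
    rwa [hl] at this
  have hcl : c ∈ l := by
    have := (R.le_iff m y).1 (hyM m hm) hcm
    rwa [hl] at this
  obtain ⟨k, hk, rfl⟩ := List.getElem_of_mem hul
  obtain ⟨r, hr, rfl⟩ := List.getElem_of_mem hcl
  have hkr : k ≠ r := by
    rintro rfl
    exact huc.ne rfl
  have hend : ∀ x ∈ M, ¬ (i x < k ∧ k + 1 < j x) := by
    rintro x hx ⟨h1, h2⟩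
    obtain ⟨h3, h4, h5⟩ := hint x (hyM x hx)
    obtain ⟨k, rfl⟩ : ∃ k', k = k' + 1 := ⟨k - 1, by omega⟩
    have h6 := (R.endsAt_iff.1 (hends x hx)).2 l[k] ((h5 k (by omega)).2 (by omega))
      l[k + 1 + 1] ((h5 (k + 1 + 1) (by omega)).2 (by omega)) (hadj k (by omega)).symm
      (hadj (k + 1) (by omega))
    have := (hnd.getElem_inj_iff).1 h6
    omega
  -- All the intervals have `k` as an extremity and contain `r ≠ k`, so they extend from `k` in the
  -- same direction and are nested.
  refine isCliqueModule_of_comparable hnt fun x hx w hw => ?_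
  rw [le_iff_of_interval hl hint (hyM x hx) (hyM w hw),
    le_iff_of_interval hl hint (hyM w hw) (hyM x hx)]
  have a1 := hend x hx
  have a2 := hend w hw
  have b1 := ((hint x (hyM x hx)).2.2 k hk).1 (huM x hx)
  have b2 := ((hint w (hyM w hw)).2.2 k hk).1 (huM w hw)
  have c1 := ((hint x (hyM x hx)).2.2 r hr).1 (hcM x hx)
  have c2 := ((hint w (hyM w hw)).2.2 r hr).1 (hcM w hw)
  omega

/-- Blockedness is asserted for this very `R`, and a modification creates no new ending pair; these
serve (1) and (2) respectively. -/
theorem exists_avoiding_or_isBlocked [Finite X] (hP : IsDuallyCPT X) (R : Rep X) {M : Set X}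
    (hM : IsNontrivialStrongModule M) (hR : ¬ R.AvoidsTrivial M) :
    (IsCliqueModule M ∧ R.IsBlocked M) ∨
      ∃ R' : Rep X, (∀ m ∈ M, ∀ z, ¬ R'.EndsOnTrivial m z) ∧
        ∀ x z, R'.EndsOnTrivial x z → R.EndsOnTrivial x z := by
  have hMo := hM.1.isOrderModule
  have hnt := hM.2.1
  unfold AvoidsTrivial at hR
  push Not at hR
  obtain ⟨m0, hm0, z0, hz0, hE⟩ := hR
  have hlow : z0 ∉ M → z0 ∈ lowerOf M := by
    intro hz
    have hlt : z0 < m0 := lt_of_le_of_ne hE.le fun h => hz (h ▸ hm0)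
    rcases hMo z0 hz with h | h | h
    · exact h
    · exact absurd (h.2 m0 hm0) hlt.not_gt
    · exact absurd hlt (h m0 hm0).2
  by_cases htriv : ∃ z ∈ M, ∃ a, R.path z = {a}
  · right
    obtain ⟨z, hz, a, hza⟩ := htriv
    have hL : ∀ x, x ∉ lowerOf M := by
      intro x hx
      have h := (R.lt_iff x z).1 (hx.2 z hz)
      rw [hza, Set.ssubset_singleton_iff] at h
      exact (R.path_nonempty x).ne_empty h
    -- A trivial path in `M` excludes lower elements, so `z0` is in `M`; the exception for
    -- components in `AvoidsTrivial` then supplies an outside comparable element, necessarily upper.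
    obtain ⟨y, hy, x, hx, hyx⟩ := hz0.resolve_left fun h => hL _ (hlow h)
    have hyU : y ∈ upperOf M := by
      rcases hMo y hy with h | h | h
      · exact absurd h (hL y)
      · exact h
      · rcases hyx with h' | h'
        · exact absurd h' (h x hx).2
        · exact absurd h' (h x hx).1
    exact R.exists_avoiding_of_trivial_mem hMo hnt hz hza hyU
  push Not at htriv
  obtain ⟨a0, hza0, -⟩ := hE
  have hz0L : z0 ∈ lowerOf M := hlow fun h => htriv z0 h a0 hza0
  obtain ⟨i, j, hij⟩ := hP.2.some.exists_dim_two_of_ge (M := M) (y := z0)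
    fun m hm => (hz0L.2 m hm).le
  have hlowmem : ∀ z ∈ lowerOf M, ∀ u, R.path z = {u} → ∀ x ∈ M, u ∈ R.path x :=
    fun z hz u hu x hx => (R.le_iff z x).1 (hz.2 x hx).le (hu ▸ rfl)
  obtain ⟨m, hm, u, K, v, hl, hpath, hv⟩ : ∃ m ∈ M, ∃ u K v, IsPathList R.T (u :: K ++ [v]) ∧
      R.path m = {w | w ∈ u :: K ++ [v]} ∧ ∀ z ∈ lowerOf M, R.path z ≠ {v} := by
    -- Otherwise each path of `M` has both ends on lower trivial paths, which lie in every path of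
    -- `M`; by convexity any two paths of `M` would contain each other.
    by_contra! hcon
    have hle : ∀ x ∈ M, ∀ y ∈ M, x ≤ y := by
      intro x hx y hy
      obtain ⟨u, K, v, hl, h⟩ := R.exists_list_two_le (htriv x hx)
      obtain ⟨z, hz, hzv⟩ := hcon x hx u K v hl h
      obtain ⟨z', hz', hzu⟩ := hcon x hx v K.reverse u (by simpa using hl.reverse)
        (by rw [h]; ext; simp; tauto)
      exact subset_of_mem_ends hl h (hlowmem z' hz' u hzu y hy) (hlowmem z hz v hzv y hy)
    obtain ⟨x, hx, y, hy, hxy⟩ := hnt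
    exact hxy (le_antisymm (hle x hx y hy) (hle y hy x hx))
  have hmem : ∀ w, w ∈ R.path m ↔ w ∈ u :: K ++ [v] := fun w => by rw [hpath]; rfl
  by_cases hu : ∀ z ∈ lowerOf M, R.path z ≠ {u}
  · right
    refine R.exists_avoiding_of_path hMo hij hl ?_ ?_ hu hv ?_
    · exact fun x hx w hw => (R.le_iff m x).1 (hx.2 m hm).le ((hmem w).2 hw)
    · exact fun x hx w hw => (hmem w).1 ((R.le_iff x m).1 (hx.2 m hm).le hw)
    · intro x hx hxL hxU
      have hinc : ∀ m ∈ M, ¬ m < x ∧ ¬ x < m := ((hMo x hx).resolve_left hxL).resolve_left hxU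
      have hne : x ≠ m := fun h => hx (h ▸ hm)
      constructor
      · intro h
        exact (hinc m hm).1 (lt_of_le_of_ne ((R.le_iff m x).2 fun w hw =>
          h w ((hmem w).1 hw)) hne.symm)
      · intro h
        refine (hinc m hm).2 (lt_of_le_of_ne ((R.le_iff x m).2 fun w hw => (hmem w).2 ?_) hne)
        exact List.mem_append_left _ (List.mem_cons_of_mem _ (h w hw))
  push Not at hu
  obtain ⟨z, hz, hzu⟩ := hu
  by_cases hb : ∃ b, R.T.Adj u b ∧ b ∉ R.path m ∧ ∀ x ∈ upperOf M, b ∈ R.path x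
  · obtain ⟨b, hub, hbm, hbU⟩ := hb
    exact Or.inr (R.exists_avoiding_of_adj hMo hij hm hl hpath hv hub hbm hbU)
  by_cases hU : ∃ y, y ∈ upperOf M
  · obtain ⟨y, hy⟩ := hU
    left
    exact R.isBlocked_of_forall_adj hnt htriv hm hz hy hzu
      (isPathEndingAt_iff_list.2 ⟨K ++ [v], hl, hpath⟩)
      fun b hub hbm hbU => hb ⟨b, hub, hbm, hbU⟩
  · right
    -- Without upper elements, a new leaf attached at `u` can play the role of `b`.
    obtain ⟨R1, f, w, hf, hw, hadj, hlist, hp, hE1⟩ := R.exists_addLeaf u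
    have hv1 : ∀ z ∈ lowerOf M, R1.path z ≠ {f v} := by
      intro z hz h
      rw [hp, ← Set.image_singleton] at h
      exact hv z hz (hf.image_injective h)
    have hw1 : w ∉ R1.path m := by
      rw [hp]
      rintro ⟨a, -, h⟩
      exact hw ⟨a, h⟩
    obtain ⟨R2, h1, h2⟩ := R1.exists_avoiding_of_adj hMo hij hm (K := K.map f)
      (by simpa using hlist _ hl) (by rw [hp, hpath]; ext; simp [eq_comm]) hv1 hadj hw1
      (fun x hx => absurd ⟨x, hx⟩ hU)
    exact ⟨R2, h1, fun x z h => hE1 x z (h2 x z h)⟩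

end Rep

end CPT

theorem mainTheorem3 {X : Type*} [PartialOrder X] [Finite X] [Nonempty X]
    (hP : CPT.IsDuallyCPT X) :
    (∀ M : Set X, CPT.IsNontrivialStrongModule M →
      (∃ R : CPT.Rep X, R.AvoidsTrivial M) ∨
        (CPT.IsCliqueModule M ∧ ∀ R : CPT.Rep X, R.IsBlocked M)) ∧
    (∃ R : CPT.Rep X, R.IsNormalized) := by
  constructor
  · intro M hM
    by_cases h : ∃ R : CPT.Rep X, R.AvoidsTrivial M
    · exact Or.inl h
    push Not at h
    have key : ∀ R : CPT.Rep X, CPT.IsCliqueModule M ∧ R.IsBlocked M := by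
      intro R
      refine (R.exists_avoiding_or_isBlocked hP hM (h R)).resolve_right ?_
      rintro ⟨R', hR', -⟩
      exact h R' fun m hm z _ => hR' m hm z
    exact Or.inr ⟨(key hP.1.some).1, fun R => (key R).2⟩
  -- Minimizing over all ending pairs handles every module at once: repairing one module cannot
  -- spoil another, and it removes at least the pair `(m, z)` witnessing its failure.
  · let E : CPT.Rep X → ℕ := fun R => {p : X × X | R.EndsOnTrivial p.1 p.2}.ncard
    obtain ⟨R, hR⟩ : ∃ R, ∀ R', E R ≤ E R' := by
      have : Nonempty (CPT.Rep X) := hP.1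
      exact ⟨Function.argmin E, fun R' => Function.argmin_le E R'⟩
    refine ⟨R, fun M hM => ?_⟩
    by_contra! hcon
    obtain ⟨h1, h2⟩ := hcon
    rcases R.exists_avoiding_or_isBlocked hP hM h1 with h | ⟨R', hR', hE⟩
    · exact h2 h.1 h.2
    · refine (hR R').not_gt (Set.ncard_lt_ncard ?_ (Set.toFinite _))
      refine (Set.ssubset_iff_of_subset fun p hp => hE p.1 p.2 hp).2 ?_
      unfold CPT.Rep.AvoidsTrivial at h1
      push Not at h1
      obtain ⟨m, hm, z, -, hmz⟩ := h1
      exact ⟨(m, z), hmz, hR' m hm z⟩
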